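/- Let $d\in\{2,3\}$ and let $C_\sigma,C_1,c_2,\gamma,c_3,C_q>0$. There is a constant $C_{\rm eig}>0$, depending only on $d,C_\sigma,C_1,c_2,\gamma,c_3,C_q$, such that the following holds. Let $\Omega\subset\mathbb R^d$ be a bounded convex polygonal ($d=2$) or polyhedral ($d=3$) domain, and let $\mathcal T$ be a finite partition of $\Omega$ into pairwise disjoint, nonempty, open polygonal/polyhedral elements $\kappa$ (not necessarily convex, hanging nodes allowed; $\overline\kappa$ is a finite union of simplices and $\kappa$ is the interior of $\overline\kappa$), with $\overline\Omega=\bigcup_\kappa\overline\kappa$. Let $\mathcal F$ be a finite set of nonoverlapping closed $(d-1)$-dimensional simplices (faces) with union $\bigcup_\kappa\partial\kappa$, each of which is either interior, i.e. contained in $\partial\kappa$ for exactly two elements $\kappa=\kappa^\pm$, or a boundary face, i.e. contained in $\partial\Omega$ and in $\partial\kappa$ for exactly one element $\kappa=\kappa^+$. Write $h_\kappa$ for the diameter of $\kappa$, $h=\max_\kappa h_\kappa$, and $|\cdot|$ for $d$- or $(d-1)$-dimensional measure. Assume that for every $\kappa\in\mathcal T$: 1. (trace covering) there are finitely many nonoverlapping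 (not necessarily shape-regular) $d$-simplices $T_\ell\subseteq\overline\kappa$ such that for every face $F\subset\partial\kappa$ there is an $\ell$ with $F=\partial\kappa\cap\partial T_\ell$ and $h_\kappa\le C_1\, d\,|T_\ell|/|F|$; 2. (shape-regularity) $h_\kappa^d\ge|\kappa|\ge c_2h_\kappa^d$; 3. (shape-regular sub-triangulation) $\overline\kappa$ is the union of finitely many nonoverlapping closed simplices $\mathfrak s_i$ with $|\mathfrak s_i|\ge c_3|\kappa|$, each containing a ball of radius at least $\operatorname{diam}(\mathfrak s_i)/\gamma$; 4. (quasi-uniformity) $h\le C_q h_\kappa$. For an integer $p\ge1$ let $V=\{v\in L^2(\Omega): v|_\kappa \text{ is a polynomial of total degree at most } p \text{ for every } \kappa\in\mathcal T\}$, and for $u,v\in V$ let $$\mathcal A(u,v)=\sum_{\kappa\in\mathcal T}\int_\kappa\nabla u\cdot\nabla v\,dx-\sum_{F\in\mathcal F}\int_F\big(\{\!\{\nabla u\}\!\}\cdot[\![v]\!]+[\![u]\!]\cdot\{\!\{\nabla v\}\!\}\big)\,ds+\sum_{F\in\mathcal F}\int_F\sigma\,[\![u]\!]\cdot[\![v]\!]\,ds,$$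 where, with traces $v^\pm$ from $\kappa^\pm$ and outward unit normals $\mathbf n^\pm$ of $\kappa^\pm$, $[\![v]\!]=v^+\mathbf n^++v^-\mathbf n^-$ and $\{\!\{\nabla v\}\!\}=\tfrac12(\nabla v^++\nabla v^-)$ on interior faces, $[\![v]\!]=v^+\mathbf n^+$ and $\{\!\{\nabla v\}\!\}=\nabla v^+$ on boundary faces, and $\sigma=C_\sigma\max\{p^2/h_\kappa\}$ on a face, the maximum being over the one or two elements having this face. Then $$\mathcal A(u,u)\le C_{\rm eig}\,\frac{p^4}{h^2}\,\|u\|_{L^2(\Omega)}^2\qquad\text{for all }u\in V.$$ Moreover, there is exactly one linear operator $A:V\to V$ with $(Au,v)_{L^2(\Omega)}=\mathcal A(u,v)$ for all $u,v\in V$ (the stiffness operator; it is symmetric), and its spectral radius is at most $C_{\rm eig}\,p^4/h^2$. -/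

import Mathlib

noncomputable section

namespace PolyDG

open MeasureTheory
open scoped Classical ENNReal

/-- The Euclidean space `ℝ^d`. -/
abbrev Euc (d : ℕ) : Type := EuclideanSpace ℝ (Fin d)

/-- `S` is a closed nondegenerate `n`-dimensional simplex in `ℝ^d`. -/
def IsSimplex {d : ℕ} (n : ℕ) (S : Set (Euc d)) : Prop :=
  ∃ s : Affine.Simplex ℝ (Euc d) n, S = convexHull ℝ (Set.range s.points)

/-- The `d`-dimensional (Lebesgue) measure of a set. -/
def vol {d : ℕ} (A : Set (Euc d)) : ℝ := (volume : Measure (Euc d)).real A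

/-- The surface measure in `ℝ^d`: the `(d-1)`-dimensional Hausdorff measure, normalized to agree
with `(d-1)`-dimensional Lebesgue measure on hyperplanes. -/
def surf (d : ℕ) : Measure (Euc d) := Measure.euclideanHausdorffMeasure (d - 1)

/-- The surface area of a set. -/
def area {d : ℕ} (A : Set (Euc d)) : ℝ := (surf d).real A

/-- A bounded convex polygonal (`d = 2`) or polyhedral (`d = 3`) domain. -/
structure IsConvexPolytopalDomain {d : ℕ} (Ω : Set (Euc d)) : Prop where
  isOpen : IsOpen Ω
  nonempty : Ω.Nonempty
  convex : Convex ℝ Ω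
  closure_eq : ∃ s : Finset (Euc d), closure Ω = convexHull ℝ (s : Set (Euc d))

/-- An open polygonal/polyhedral element, not necessarily convex: a nonempty open set without
slits whose closure is a finite union of simplices. -/
structure IsPolytopalElement {d : ℕ} (κ : Set (Euc d)) : Prop where
  isOpen : IsOpen κ
  nonempty : κ.Nonempty
  interior_closure : interior (closure κ) = κ
  closure_eq : ∃ 𝒮 : Finset (Set (Euc d)), (∀ S ∈ 𝒮, IsSimplex d S) ∧ closure κ = ⋃ S ∈ 𝒮, S

/-- A partition of `Ω` into polygonal/polyhedral elements, together with the given subdivision of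
the interfaces (hanging nodes allowed) into `(d-1)`-dimensional simplices, the faces. -/
structure PolyMesh {d : ℕ} (Ω : Set (Euc d)) where
  /-- the elements of the partition -/
  elements : Finset (Set (Euc d))
  /-- the faces of the partition -/
  faces : Finset (Set (Euc d))
  isPolytopal : ∀ κ ∈ elements, IsPolytopalElement κ
  subset : ∀ κ ∈ elements, κ ⊆ Ω
  disjoint : (elements : Set (Set (Euc d))).Pairwise Disjoint
  closure_eq : closure Ω = ⋃ κ ∈ elements, closure κ
  isSimplex_face : ∀ F ∈ faces, IsSimplex (d - 1) F
  /-- distinct faces do not overlap -/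
  face_overlap : ∀ F ∈ faces, ∀ F' ∈ faces, F ≠ F' → surf d (F ∩ F') = 0
  /-- the faces make up the element boundaries -/
  iUnion_faces : ⋃ F ∈ faces, F = ⋃ κ ∈ elements, frontier κ
  /-- each face is either an interior face, shared by exactly two elements `κ⁺` and `κ⁻`, or a
  boundary face, contained in `∂Ω` and belonging to exactly one element `κ⁺` -/
  interior_or_boundary : ∀ F ∈ faces,
    (∃ κ₁ κ₂, κ₁ ≠ κ₂ ∧ elements.filter (fun κ => F ⊆ frontier κ) = {κ₁, κ₂}) ∨
    (F ⊆ frontier Ω ∧ ∃ κ₁, elements.filter (fun κ => F ⊆ frontier κ) = {κ₁})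

namespace PolyMesh

variable {d : ℕ} {Ω : Set (Euc d)} (T : PolyMesh Ω)

/-- The elements having `F` as a face: `{κ⁺, κ⁻}` for an interior face, `{κ⁺}` for a boundary
face. -/
def neighbors (F : Set (Euc d)) : Finset (Set (Euc d)) :=
  T.elements.filter (fun κ => F ⊆ frontier κ)

/-- The mesh size: the maximum of the element diameters. -/
def meshSize : ℝ := sSup (Metric.diam '' (T.elements : Set (Set (Euc d))))

/-- Trace covering: every element contains nonoverlapping `d`-simplices (not necessarily
shape-regular) such that each face `F ⊆ ∂κ` equals `∂κ ∩ ∂S` for one of them, `S`, and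
`h_κ ≤ C d |S| / |F|`. -/
def TraceCovering (C : ℝ) : Prop :=
  ∀ κ ∈ T.elements, ∃ 𝒮 : Finset (Set (Euc d)),
    (∀ S ∈ 𝒮, IsSimplex d S ∧ S ⊆ closure κ) ∧
    (∀ S ∈ 𝒮, ∀ S' ∈ 𝒮, S ≠ S' → Disjoint (interior S) (interior S')) ∧
    ∀ F ∈ T.faces, F ⊆ frontier κ →
      ∃ S ∈ 𝒮, F = frontier κ ∩ frontier S ∧ Metric.diam κ ≤ C * (d * vol S / area F)

/-- Shape regularity of the elements: `h_κ^d ≥ |κ| ≥ c h_κ^d`. -/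
def ShapeRegular (c : ℝ) : Prop :=
  ∀ κ ∈ T.elements, vol κ ≤ Metric.diam κ ^ d ∧ c * Metric.diam κ ^ d ≤ vol κ

/-- Shape-regular sub-triangulation: every element is subdivided into finitely many nonoverlapping
simplices `S`, each of which contains a ball of radius `r` with `diam S ≤ γ r` and has measure
`|S| ≥ c |κ|`. -/
def ShapeRegularSubtriangulation (γ c : ℝ) : Prop :=
  ∀ κ ∈ T.elements, ∃ 𝒮 : Finset (Set (Euc d)),
    (∀ S ∈ 𝒮, IsSimplex d S ∧
      (∃ z r, Metric.closedBall z r ⊆ S ∧ Metric.diam S ≤ γ * r) ∧ c * vol κ ≤ vol S) ∧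
    (∀ S ∈ 𝒮, ∀ S' ∈ 𝒮, S ≠ S' → Disjoint (interior S) (interior S')) ∧
    closure κ = ⋃ S ∈ 𝒮, S

/-- Quasi-uniformity: `h ≤ C h_κ` for all elements. -/
def QuasiUniform (C : ℝ) : Prop :=
  ∀ κ ∈ T.elements, T.meshSize ≤ C * Metric.diam κ

end PolyMesh

/-- The function on `ℝ^d` given by a polynomial in `d` variables. -/
def polyFun {d : ℕ} (P : MvPolynomial (Fin d) ℝ) (x : Euc d) : ℝ :=
  MvPolynomial.eval (fun i => x i) P

/-- The DG space of functions in `L²(Ω)` that are, on each element, a polynomial of total degree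
at most `p`. -/
def dgSpace {d : ℕ} {Ω : Set (Euc d)} (T : PolyMesh Ω) (p : ℕ) :
    Submodule ℝ (Lp ℝ 2 ((volume : Measure (Euc d)).restrict Ω)) where
  carrier := {v | ∀ κ ∈ T.elements, ∃ P : MvPolynomial (Fin d) ℝ, P.totalDegree ≤ p ∧
    ∀ᵐ x ∂((volume : Measure (Euc d)).restrict κ), v x = polyFun P x}
  zero_mem' := by
    intro κ hκ
    refine ⟨0, by simp, ?_⟩
    have h := Lp.coeFn_zero ℝ 2 ((volume : Measure (Euc d)).restrict Ω)
    have h' := ae_restrict_of_ae_restrict_of_subset (T.subset κ hκ) h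
    filter_upwards [h'] with x hx
    rw [hx]
    simp [polyFun]
  add_mem' := by
    intro u v hu hv κ hκ
    obtain ⟨P, hP, hPu⟩ := hu κ hκ
    obtain ⟨Q, hQ, hQv⟩ := hv κ hκ
    refine ⟨P + Q, (MvPolynomial.totalDegree_add P Q).trans (max_le hP hQ), ?_⟩
    have h' := ae_restrict_of_ae_restrict_of_subset (T.subset κ hκ) (Lp.coeFn_add u v)
    filter_upwards [h', hPu, hQv] with x hx h1 h2
    rw [hx, Pi.add_apply, h1, h2]
    simp [polyFun]
  smul_mem' := by
    intro c u hu κ hκ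
    obtain ⟨P, hP, hPu⟩ := hu κ hκ
    refine ⟨c • P, (MvPolynomial.totalDegree_smul_le c P).trans hP, ?_⟩
    have h' := ae_restrict_of_ae_restrict_of_subset (T.subset κ hκ) (Lp.coeFn_smul c u)
    filter_upwards [h', hPu] with x hx h1
    rw [hx, Pi.smul_apply, h1]
    simp [polyFun]

/-- `n` is the outward unit normal of `κ` at `x`: near `x`, the set `κ` is the open half-space
`{y | ⟪y - x, n⟫ < 0}`. -/
def IsOutwardNormal {d : ℕ} (κ : Set (Euc d)) (x n : Euc d) : Prop :=
  ‖n‖ = 1 ∧ ∀ᶠ y in nhds x, y ∈ κ ↔ inner ℝ (y - x) n < 0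

/-- The outward unit normal of `κ` at `x`. It exists at almost every boundary point of a polytope;
the value at the other points is irrelevant. -/
def outwardNormal {d : ℕ} (κ : Set (Euc d)) (x : Euc d) : Euc d :=
  if h : ∃ n, IsOutwardNormal κ x n then h.choose else 0

section Form

variable {d : ℕ} {Ω : Set (Euc d)} {T : PolyMesh Ω} {p : ℕ}

/-- The polynomial function that equals `u` on the element `κ`. Its values on `∂κ` are the traces
of `u` from the interior of `κ`, its gradient is that of `u` on `κ`, with traces on `∂κ`. -/
def localPoly (u : dgSpace T p) (κ : Set (Euc d)) : Euc d → ℝ :=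
  if h : κ ∈ T.elements then polyFun (u.2 κ h).choose else 0

/-- The jump `u⁺ n⁺ + u⁻ n⁻` on an interior face, `u⁺ n⁺` on a boundary face. -/
def jump (u : dgSpace T p) (F : Set (Euc d)) (x : Euc d) : Euc d :=
  ∑ κ ∈ T.neighbors F, localPoly u κ x • outwardNormal κ x

/-- The average `(∇u⁺ + ∇u⁻) / 2` on an interior face, `∇u⁺` on a boundary face. -/
def avgGrad (u : dgSpace T p) (F : Set (Euc d)) (x : Euc d) : Euc d :=
  ((T.neighbors F).card : ℝ)⁻¹ • ∑ κ ∈ T.neighbors F, gradient (localPoly u κ) x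

/-- The interior penalty parameter on a face: the maximum of `Cσ p² / h_κ` over the elements
having this face. -/
def penalty (T : PolyMesh Ω) (p : ℕ) (Cσ : ℝ) (F : Set (Euc d)) : ℝ :=
  Cσ * sSup ((fun κ => (p : ℝ) ^ 2 / Metric.diam κ) '' (T.neighbors F : Set (Set (Euc d))))

/-- The symmetric interior penalty discontinuous Galerkin bilinear form. -/
def sipg (Cσ : ℝ) (u v : dgSpace T p) : ℝ :=
  (∑ κ ∈ T.elements,
      ∫ x in κ, inner ℝ (gradient (localPoly u κ) x) (gradient (localPoly v κ) x))
  - (∑ F ∈ T.faces,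
      ∫ x in F, (inner ℝ (avgGrad u F x) (jump v F x) + inner ℝ (jump u F x) (avgGrad v F x))
        ∂(surf d))
  + (∑ F ∈ T.faces,
      ∫ x in F, penalty T p Cσ F * inner ℝ (jump u F x) (jump v F x) ∂(surf d))

/-- `A` is the stiffness operator: `(A u, v)_{L²(Ω)}` is the value of the bilinear form at
`(u, v)`. -/
def IsStiffnessOperator (Cσ : ℝ) (A : Module.End ℝ (dgSpace T p)) : Prop :=
  ∀ u v : dgSpace T p, inner ℝ (A u) v = sipg Cσ u v

end Form

end PolyDG

end

/-!
The quadratic form `𝒜(u, u)` is bounded by `p⁴ / h²` times `‖u‖²` as soon as a polynomial `v` of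
degree at most `p` on an element `κ` satisfies an inverse inequality
`‖∇v‖²_κ ≲ p⁴ / h² ‖v‖²_κ` and a trace inequality `‖v‖²_∂κ ≲ p² / h ‖v‖²_κ`
(`exists_element_estimates`). Indeed, Young's inequality with the weights `h / p²` and `p² / h` splits
the consistency terms on the faces into squares of averages and of jumps, and the penalty is
`≲ p² / h` (`abs_face_term_le`, `exists_abs_sipg_le`).

Both inequalities are proved on the simplices of the shape-regular sub-triangulation, each of which
contains a ball of radius comparable to `h`; the boundary of `κ` is covered by the boundaries of
these simplices. They are reduced to two inequalities on `[0, 1]` with the weight `tⁿ`, `n = d - 1`: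
`∫ tⁿ (t q')² ≲ p⁴ ∫ tⁿ q²` (`unitIntegral_markov`) and `q(1)² ≲ p² ∫ tⁿ q²` (`eval_one_sq_le`). These
follow, by integration by parts, from the `L²` Bernstein inequality for Jacobi weights
(`jacobi_bernstein`), which only says that the Jacobi operator is symmetric and has the eigenvalues
`k (k + a + b + 1)` on polynomials.

* Inverse inequality: in polar coordinates around a point `y` of a convex body `S`, the weighted
  Markov inequality gives `∫_S |(x - y) · ∇v|² ≲ p⁴ ∫_S v²`, with a constant independent of `S`
  (`lintegral_radialDeriv_sq_le`). If `S` contains the ball of radius `r` with centre `z`, the choices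
  `y = z` and `y = z + r eᵢ` yield `r² ∫_S |∂ᵢ v|² ≲ p⁴ ∫_S v²` (`lintegral_pderiv_sq_le`).
* Trace inequality: a facet of a simplex lies in a hyperplane at distance `ρ ≥ r` from `z`. Fubini's
  theorem on the cone with apex `z` over the facet (`lintegral_cone_le`) produces the weight `tⁿ`
  along the rays from `z`, where the one-dimensional trace inequality applies.

The outward normal is locally constant on a relatively open part of the boundary and zero elsewhere,
hence measurable, so that the form is bilinear; since the discontinuous Galerkin space is
finite-dimensional, the form is represented by a unique operator, whose real eigenvalues are values
of the quadratic form at unit vectors.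
-/

namespace PolyDG

open MeasureTheory
open scoped ENNReal

/-! ### One-dimensional polynomial inequalities with Jacobi weights -/

section OneDim

open Polynomial

/-- The integral of a polynomial over `[0, 1]`, as a linear functional. -/
noncomputable def unitIntegral : ℝ[X] →ₗ[ℝ] ℝ where
  toFun P := ∫ t in (0 : ℝ)..1, P.eval t
  map_add' P Q := by
    simp only [eval_add]
    exact intervalIntegral.integral_add (P.continuous.intervalIntegrable _ _)
      (Q.continuous.intervalIntegrable _ _)
  map_smul' c P := by simp

theorem unitIntegral_derivative (P : ℝ[X]) :
    unitIntegral (derivative P) = P.eval 1 - P.eval 0 :=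
  intervalIntegral.integral_eq_sub_of_hasDerivAt (fun x _ => P.hasDerivAt x)
    ((derivative P).continuous.intervalIntegrable _ _)

theorem unitIntegral_nonneg {P : ℝ[X]} (h : ∀ t ∈ Set.Icc (0 : ℝ) 1, 0 ≤ P.eval t) :
    0 ≤ unitIntegral P :=
  intervalIntegral.integral_nonneg zero_le_one h

theorem unitIntegral_mono {P Q : ℝ[X]} (h : ∀ t ∈ Set.Icc (0 : ℝ) 1, P.eval t ≤ Q.eval t) :
    unitIntegral P ≤ unitIntegral Q :=
  intervalIntegral.integral_mono_on zero_le_one (P.continuous.intervalIntegrable _ _)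
    (Q.continuous.intervalIntegrable _ _) h

theorem unitIntegral_pos {P : ℝ[X]} (hP : P ≠ 0)
    (h : ∀ t ∈ Set.Icc (0 : ℝ) 1, 0 ≤ P.eval t) : 0 < unitIntegral P := by
  refine intervalIntegral.integral_pos zero_lt_one P.continuous.continuousOn
    (fun t ht => h t ⟨ht.1.le, ht.2⟩) ?_
  by_contra! hc
  refine hP (Polynomial.eq_zero_of_infinite_isRoot P
    ((Set.Icc_infinite (zero_lt_one' ℝ)).mono fun t ht => ?_))
  exact le_antisymm (hc t ht) (h t ht)

/-- A symmetric operator on a finite-dimensional inner product space is bounded above, as a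
quadratic form, by any bound for its eigenvalues. -/
theorem inner_le_of_eigenvalue_le {E : Type*} [NormedAddCommGroup E] [InnerProductSpace ℝ E]
    [FiniteDimensional ℝ E] {L : E →ₗ[ℝ] E} (hL : L.IsSymmetric) {Λ : ℝ}
    (hΛ : ∀ μ, Module.End.HasEigenvalue L μ → μ ≤ Λ) (x : E) :
    inner ℝ (L x) x ≤ Λ * inner ℝ x x := by
  set b := hL.eigenvectorBasis rfl
  rw [← b.sum_inner_mul_inner (L x) x, ← b.sum_inner_mul_inner x x, Finset.mul_sum]
  refine Finset.sum_le_sum fun i _ => ?_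
  have h1 : inner ℝ (L x) (b i) = hL.eigenvalues rfl i * inner ℝ x (b i) := by
    rw [hL x (b i), hL.apply_eigenvectorBasis rfl i]
    simp [inner_smul_right, b]
  rw [h1, mul_assoc]
  refine mul_le_mul_of_nonneg_right (hΛ _ (hL.hasEigenvalue_eigenvalues rfl i)) ?_
  rw [real_inner_comm x (b i)]
  exact mul_self_nonneg _

/-- The Jacobi weight `t ^ a * (1 - t) ^ b`. -/
noncomputable def jacobiWeight (a b : ℕ) : ℝ[X] := X ^ a * (1 - X) ^ b

theorem jacobiWeight_nonneg (a b : ℕ) {t : ℝ} (ht : t ∈ Set.Icc (0 : ℝ) 1) :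
    0 ≤ (jacobiWeight a b).eval t := by
  have h1 : 0 ≤ 1 - t := by linarith [ht.2]
  simp only [jacobiWeight, eval_mul, eval_pow, eval_X, eval_sub, eval_one]
  exact mul_nonneg (pow_nonneg ht.1 _) (pow_nonneg h1 _)

theorem jacobiWeight_ne_zero (a b : ℕ) : jacobiWeight a b ≠ 0 := by
  refine mul_ne_zero (pow_ne_zero _ X_ne_zero) (pow_ne_zero _ fun h => ?_)
  have := congrArg (Polynomial.eval 0) h
  simp at this

/-- The Jacobi differential operator
`q ↦ -(t (1 - t) q'' + ((a + 1) (1 - t) - (b + 1) t) q')`. -/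
noncomputable def jacobiOp (a b : ℕ) : ℝ[X] →ₗ[ℝ] ℝ[X] :=
  -(LinearMap.mulLeft ℝ (X * (1 - X)) ∘ₗ derivative ∘ₗ derivative +
    LinearMap.mulLeft ℝ (C (a + 1 : ℝ) * (1 - X) - C (b + 1 : ℝ) * X) ∘ₗ derivative)

theorem jacobiOp_apply (a b : ℕ) (q : ℝ[X]) : jacobiOp a b q =
    -(X * (1 - X) * derivative (derivative q) +
      (C (a + 1 : ℝ) * (1 - X) - C (b + 1 : ℝ) * X) * derivative q) := by
  simp [jacobiOp, mul_assoc]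

/-- Integration by parts: the Jacobi operator is the one of the Dirichlet form with weight
`t ^ (a + 1) * (1 - t) ^ (b + 1)`. -/
theorem unitIntegral_jacobiOp_mul (a b : ℕ) (q r : ℝ[X]) :
    unitIntegral (jacobiWeight a b * (jacobiOp a b q * r)) =
      unitIntegral (jacobiWeight (a + 1) (b + 1) * (derivative q * derivative r)) := by
  have h := unitIntegral_derivative (jacobiWeight (a + 1) (b + 1) * (derivative q * r))
  have h0 : (jacobiWeight (a + 1) (b + 1) * (derivative q * r)).eval 0 = 0 := by
    simp [jacobiWeight]
  have h1 : (jacobiWeight (a + 1) (b + 1) * (derivative q * r)).eval 1 = 0 := by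
    simp [jacobiWeight]
  have e : derivative (jacobiWeight (a + 1) (b + 1) * (derivative q * r)) =
      jacobiWeight (a + 1) (b + 1) * (derivative q * derivative r)
        - jacobiWeight a b * (jacobiOp a b q * r) := by
    rw [jacobiOp_apply]
    simp only [jacobiWeight, derivative_mul, derivative_pow, derivative_sub,
      derivative_one, derivative_X]
    simp only [Nat.add_sub_cancel, Nat.cast_add, Nat.cast_one, map_add, map_one, map_natCast]
    ring
  rw [h0, h1, e, map_sub] at h
  linarith

theorem coeff_jacobiOp (a b k : ℕ) {q : ℝ[X]} (hq : q.natDegree ≤ k) :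
    (jacobiOp a b q).coeff k = k * (k + a + b + 1) * q.coeff k := by
  have h1 : q.coeff (k + 1) = 0 := coeff_eq_zero_of_natDegree_lt (by omega)
  have e : jacobiOp a b q = X * (X * derivative (derivative q)) - X * derivative (derivative q)
      - C (a + 1 : ℝ) * derivative q + C (a + b + 2 : ℝ) * (X * derivative q) := by
    rw [jacobiOp_apply]
    have : (C (a + b + 2 : ℝ) : ℝ[X]) = C (a + 1 : ℝ) + C (b + 1 : ℝ) := by
      rw [← C_add]; ring_nf
    rw [this]; ring
  rw [e]
  simp only [coeff_add, coeff_sub, coeff_C_mul]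
  rcases k with _ | _ | k
  · simp [coeff_derivative, h1]
  · have h2 : q.coeff 2 = 0 := h1
    simp [coeff_derivative, coeff_X_mul]
    linear_combination (-2 * (2 + a : ℝ)) * h2
  · simp [coeff_derivative, coeff_X_mul, h1]
    ring

theorem natDegree_jacobiOp_le (a b : ℕ) (q : ℝ[X]) :
    (jacobiOp a b q).natDegree ≤ q.natDegree := by
  rw [natDegree_le_iff_coeff_eq_zero]
  intro k hk
  rw [coeff_jacobiOp a b k hk.le, coeff_eq_zero_of_natDegree_lt hk, mul_zero]

/-- The Bernstein inequality in `L²` with a Jacobi weight: the Jacobi operator is symmetric, and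
its eigenvalues on polynomials of degree at most `p` are `k (k + a + b + 1)`, `k ≤ p`. -/
theorem jacobi_bernstein (a b p : ℕ) {q : ℝ[X]} (hq : q.natDegree ≤ p) :
    unitIntegral (jacobiWeight (a + 1) (b + 1) * derivative q ^ 2) ≤
      p * (p + a + b + 1) * unitIntegral (jacobiWeight a b * q ^ 2) := by
  let V := degreeLT ℝ (p + 1)
  have hmem : ∀ r : ℝ[X], r ∈ V ↔ r.natDegree ≤ p := fun r => by
    rcases eq_or_ne r 0 with rfl | hr
    · simp
    · rw [mem_degreeLT, degree_eq_natDegree hr, Nat.cast_lt, Nat.lt_succ_iff]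
  let core : InnerProductSpace.Core ℝ V :=
    { inner := fun f g => unitIntegral (jacobiWeight a b * ((f : ℝ[X]) * g))
      conj_inner_symm := fun f g => by simp [mul_comm (f : ℝ[X])]
      re_inner_nonneg := fun f => unitIntegral_nonneg fun t ht => by
        rw [eval_mul, eval_mul]
        exact mul_nonneg (jacobiWeight_nonneg a b ht) (mul_self_nonneg _)
      add_left := fun f g r => by simp [add_mul, mul_add]
      smul_left := fun f g r => by simp
      definite := fun f hf => by
        by_contra hne
        have hne' : (f : ℝ[X]) ≠ 0 := fun h => hne (Subtype.ext h)
        refine (unitIntegral_pos (mul_ne_zero (jacobiWeight_ne_zero a b)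
          (mul_ne_zero hne' hne')) fun t ht => ?_).ne' hf
        rw [eval_mul, eval_mul]
        exact mul_nonneg (jacobiWeight_nonneg a b ht) (mul_self_nonneg _) }
  let _ : NormedAddCommGroup V := core.toNormedAddCommGroup
  let _ : InnerProductSpace ℝ V := InnerProductSpace.ofCore core.toCore
  have hinner : ∀ f g : V,
      inner ℝ f g = unitIntegral (jacobiWeight a b * ((f : ℝ[X]) * g)) := fun f g => rfl
  have _ : FiniteDimensional ℝ V := (degreeLTEquiv ℝ (p + 1)).symm.finiteDimensional
  let L : V →ₗ[ℝ] V := (jacobiOp a b).restrict fun r hr =>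
    (hmem _).2 ((natDegree_jacobiOp_le a b r).trans ((hmem r).1 hr))
  have hLcoe : ∀ f : V, (L f : ℝ[X]) = jacobiOp a b f := fun f => rfl
  have hL : L.IsSymmetric := fun f g => by
    rw [hinner, hinner, hLcoe, hLcoe, unitIntegral_jacobiOp_mul, mul_comm (f : ℝ[X]),
      unitIntegral_jacobiOp_mul, mul_comm (derivative (f : ℝ[X]))]
  have hΛ : ∀ μ, Module.End.HasEigenvalue L μ → μ ≤ p * (p + a + b + 1) := by
    intro μ hμ
    obtain ⟨f, hf⟩ := hμ.exists_hasEigenvector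
    have hf0 : (f : ℝ[X]) ≠ 0 := fun h => hf.2 (Subtype.ext h)
    have he : jacobiOp a b f = μ • (f : ℝ[X]) := by
      rw [← hLcoe, hf.apply_eq_smul]; rfl
    have hc := coeff_jacobiOp a b _ (le_refl (f : ℝ[X]).natDegree)
    rw [he, coeff_smul, smul_eq_mul] at hc
    have hμ' := mul_right_cancel₀ (leadingCoeff_ne_zero.2 hf0) hc
    have hdeg : ((f : ℝ[X]).natDegree : ℝ) ≤ p := by exact_mod_cast (hmem f).1 f.2
    rw [hμ']
    gcongr
  have h := inner_le_of_eigenvalue_le hL hΛ ⟨q, (hmem q).2 hq⟩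
  rw [hinner, hinner, hLcoe, unitIntegral_jacobiOp_mul] at h
  simpa only [sq] using h

/-- The weight `1 - t` can be dropped at the expense of a factor `p²`: integrate
`(1 - t) (t ^ (n + 2) g²)'` by parts and apply the Bernstein inequality with the weight
`t ^ (n + 1) (1 - t)`. -/
theorem unitIntegral_drop_weight (n p : ℕ) {g : ℝ[X]} (hg : g.natDegree ≤ p) :
    unitIntegral (X ^ (n + 2) * g ^ 2) ≤
      (2 * (n + 2) + 4 * (p * (p + n + 3))) * unitIntegral (jacobiWeight (n + 1) 1 * g ^ 2) := by
  have h := unitIntegral_derivative ((1 - X) * (X ^ (n + 2) * g ^ 2))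
  have e : derivative ((1 - X) * (X ^ (n + 2) * g ^ 2)) =
      (n + 2 : ℝ) • (jacobiWeight (n + 1) 1 * g ^ 2) +
      (2 : ℝ) • ((1 - X) * X ^ (n + 2) * g * derivative g) - X ^ (n + 2) * g ^ 2 := by
    simp only [jacobiWeight, derivative_mul, derivative_pow, derivative_sub,
      derivative_one, derivative_X, smul_eq_C_mul]
    simp only [Nat.cast_add, Nat.cast_ofNat, map_add, map_natCast, map_ofNat]
    rw [show n + 2 - 1 = n + 1 by omega]
    ring
  rw [e, map_sub, map_add, map_smul, map_smul] at h
  simp only [eval_mul, eval_sub, eval_one, eval_X, eval_pow, sub_self, zero_mul, smul_eq_mul] at h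
  rw [zero_pow (by omega)] at h
  have hB := jacobi_bernstein (n + 1) 1 p hg
  -- Young's inequality `2 (1 - t) g g' ≤ g² / 2 + 2 (1 - t)² g'²`
  have hY : unitIntegral ((2 : ℝ) • ((1 - X) * X ^ (n + 2) * g * derivative g)) ≤
      unitIntegral ((1 / 2 : ℝ) • (X ^ (n + 2) * g ^ 2) +
        (2 : ℝ) • (jacobiWeight (n + 1 + 1) (1 + 1) * derivative g ^ 2)) := by
    refine unitIntegral_mono fun t ht => ?_
    simp only [jacobiWeight, eval_smul, eval_add, eval_mul, eval_sub, eval_one, eval_X, eval_pow,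
      smul_eq_mul]
    nlinarith [mul_nonneg (pow_nonneg ht.1 (n + 2))
      (sq_nonneg (g.eval t - 2 * (1 - t) * (derivative g).eval t))]
  rw [map_add, map_smul, map_smul, map_smul] at hY
  simp only [smul_eq_mul] at hY
  push_cast at hB
  nlinarith

theorem natDegree_derivative_le' {p : ℕ} {q : ℝ[X]} (hq : q.natDegree ≤ p) :
    (derivative q).natDegree ≤ p :=
  (natDegree_derivative_le q).trans ((Nat.sub_le _ _).trans hq)

/-- The constant of the weighted Markov inequality on an interval. -/
noncomputable def markovConst (n : ℕ) : ℝ := (6 * (n + 4)) * (n + 2)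

/-- The Markov inequality in `L²(0, 1)` with the weight `t ^ n`, for the derivation `t d/dt`. -/
theorem unitIntegral_markov (n p : ℕ) (hp : 1 ≤ p) {q : ℝ[X]} (hq : q.natDegree ≤ p) :
    unitIntegral (X ^ n * (X * derivative q) ^ 2) ≤
      markovConst n * p ^ 4 * unitIntegral (X ^ n * q ^ 2) := by
  have h1 := unitIntegral_drop_weight n p (natDegree_derivative_le' hq)
  have h2 := jacobi_bernstein n 0 p hq
  have hp' : (1 : ℝ) ≤ p := by exact_mod_cast hp
  have e1 : X ^ n * (X * derivative q) ^ 2 = X ^ (n + 2) * derivative q ^ 2 := by ring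
  have e2 : jacobiWeight n 0 * q ^ 2 = X ^ n * q ^ 2 := by simp [jacobiWeight]
  rw [e2] at h2
  rw [e1]
  have hn : 0 ≤ unitIntegral (X ^ n * q ^ 2) := unitIntegral_nonneg fun t ht => by
    simp only [eval_mul, eval_pow, eval_X]
    exact mul_nonneg (pow_nonneg ht.1 _) (sq_nonneg _)
  have hw : 0 ≤ unitIntegral (jacobiWeight (n + 1) 1 * derivative q ^ 2) :=
    unitIntegral_nonneg fun t ht => by
      rw [eval_mul, eval_pow]
      exact mul_nonneg (jacobiWeight_nonneg _ _ ht) (sq_nonneg _)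
  have hn0 : (0 : ℝ) ≤ n := n.cast_nonneg
  have c1 : (2 * (n + 2) + 4 * (p * (p + n + 3)) : ℝ) ≤ 6 * (n + 4) * p ^ 2 := by
    nlinarith [mul_nonneg hn0 (sub_nonneg.2 hp'), mul_nonneg (mul_nonneg hn0 (sub_nonneg.2 hp'))
      (zero_le_one.trans hp'), sq_nonneg ((p : ℝ) - 1), hp']
  have c2 : (p * (p + n + (0 : ℕ) + 1) : ℝ) ≤ (n + 2) * p ^ 2 := by
    push_cast
    nlinarith [mul_nonneg (mul_nonneg hn0 (sub_nonneg.2 hp')) (zero_le_one.trans hp')]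
  calc _ ≤ _ := h1
    _ ≤ 6 * (n + 4) * p ^ 2 * unitIntegral (jacobiWeight (n + 1) 1 * derivative q ^ 2) := by
        gcongr
    _ ≤ 6 * (n + 4) * p ^ 2 * ((n + 2) * p ^ 2 * unitIntegral (X ^ n * q ^ 2)) := by
        gcongr
        exact h2.trans (by gcongr)
    _ = _ := by rw [markovConst]; ring

/-- The constant of the weighted trace inequality on an interval. -/
noncomputable def traceConst (n : ℕ) : ℝ := n + 2 + markovConst n

theorem markovConst_pos (n : ℕ) : 0 < markovConst n := by unfold markovConst; positivity

theorem traceConst_pos (n : ℕ) : 0 < traceConst n :=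
  add_pos (by positivity) (markovConst_pos n)

/-- The trace inequality at the end point `1` of `[0, 1]` with the weight `t ^ n`. -/
theorem eval_one_sq_le (n p : ℕ) (hp : 1 ≤ p) {q : ℝ[X]} (hq : q.natDegree ≤ p) :
    q.eval 1 ^ 2 ≤ traceConst n * p ^ 2 * unitIntegral (X ^ n * q ^ 2) := by
  have h := unitIntegral_derivative (X ^ (n + 1) * q ^ 2)
  have hp' : (1 : ℝ) ≤ p := by exact_mod_cast hp
  have hM := unitIntegral_markov n p hp hq
  have e : derivative (X ^ (n + 1) * q ^ 2) =
      (n + 1 : ℝ) • (X ^ n * q ^ 2) + (2 : ℝ) • (X ^ n * (q * (X * derivative q))) := by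
    simp only [derivative_mul, derivative_pow, derivative_X, smul_eq_C_mul]
    simp only [Nat.cast_add, Nat.cast_ofNat, map_add, map_natCast, map_ofNat,
      Nat.add_sub_cancel, map_one, Nat.cast_one]
    ring
  rw [e, map_add, map_smul] at h
  simp only [eval_mul, eval_X, eval_pow, one_pow, one_mul, smul_eq_mul] at h
  rw [zero_pow (by omega), zero_mul, sub_zero] at h
  -- Young's inequality `2 q (t q') ≤ p² q² + p⁻² (t q')²`
  have hY : unitIntegral ((2 : ℝ) • (X ^ n * (q * (X * derivative q)))) ≤
      unitIntegral (((p : ℝ) ^ 2) • (X ^ n * q ^ 2) +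
        (((p : ℝ) ^ 2)⁻¹) • (X ^ n * (X * derivative q) ^ 2)) := by
    refine unitIntegral_mono fun t ht => ?_
    simp only [eval_smul, eval_add, eval_mul, eval_X, eval_pow, smul_eq_mul]
    have hsq : 2 * (q.eval t * (t * (derivative q).eval t)) ≤
        (p : ℝ) ^ 2 * q.eval t ^ 2 + ((p : ℝ) ^ 2)⁻¹ * (t * (derivative q).eval t) ^ 2 := by
      have hp0 : (p : ℝ) ≠ 0 := by positivity
      have := sq_nonneg ((p : ℝ) * q.eval t - (p : ℝ)⁻¹ * (t * (derivative q).eval t))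
      have e3 : ((p : ℝ) * q.eval t - (p : ℝ)⁻¹ * (t * (derivative q).eval t)) ^ 2 =
          (p : ℝ) ^ 2 * q.eval t ^ 2 + ((p : ℝ) ^ 2)⁻¹ * (t * (derivative q).eval t) ^ 2
            - 2 * (q.eval t * (t * (derivative q).eval t)) := by
        field_simp
        ring
      linarith
    have := mul_le_mul_of_nonneg_left hsq (pow_nonneg ht.1 n)
    linarith
  rw [map_add, map_smul _ ((p : ℝ) ^ 2), map_smul _ ((p : ℝ) ^ 2)⁻¹] at hY
  simp only [smul_eq_mul] at hY
  have hn : 0 ≤ unitIntegral (X ^ n * q ^ 2) := unitIntegral_nonneg fun t ht => by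
    simp only [eval_mul, eval_pow, eval_X]
    exact mul_nonneg (pow_nonneg ht.1 _) (sq_nonneg _)
  have hM' : ((p : ℝ) ^ 2)⁻¹ * unitIntegral (X ^ n * (X * derivative q) ^ 2) ≤
      markovConst n * p ^ 2 * unitIntegral (X ^ n * q ^ 2) := by
    rw [inv_mul_le_iff₀ (by positivity)]
    calc _ ≤ _ := hM
      _ = _ := by ring
  have h3 : ((n : ℝ) + 1) * unitIntegral (X ^ n * q ^ 2) ≤
      (n + 1) * p ^ 2 * unitIntegral (X ^ n * q ^ 2) := by
    gcongr
    exact le_mul_of_one_le_right (by positivity) (one_le_pow₀ hp')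
  calc _ ≤ _ := h.symm.le
    _ ≤ (n + 1) * p ^ 2 * unitIntegral (X ^ n * q ^ 2) + (p ^ 2 * unitIntegral (X ^ n * q ^ 2)
        + markovConst n * p ^ 2 * unitIntegral (X ^ n * q ^ 2)) := by linarith
    _ = _ := by rw [traceConst]; ring

end OneDim

/-! ### Polynomial functions on Euclidean space -/

theorem continuous_polyFun {d : ℕ} (P : MvPolynomial (Fin d) ℝ) : Continuous (polyFun P) :=
  (MvPolynomial.continuous_eval P).comp (PiLp.continuous_ofLp 2 _)

theorem hasFDerivAt_polyFun {d : ℕ} (P : MvPolynomial (Fin d) ℝ) (x : Euc d) :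
    HasFDerivAt (polyFun P)
      (∑ i, polyFun (MvPolynomial.pderiv i P) x • EuclideanSpace.proj (𝕜 := ℝ) i) x := by
  induction P using MvPolynomial.induction_on with
  | C a =>
    have : polyFun (MvPolynomial.C a : MvPolynomial (Fin d) ℝ) = fun _ => a := by
      ext y; simp [polyFun]
    rw [this]
    simpa [polyFun] using hasFDerivAt_const (𝕜 := ℝ) a x
  | add P Q hP hQ =>
    have : polyFun (P + Q) = polyFun P + polyFun Q := by
      ext y; simp [polyFun]
    rw [this]
    convert! hP.add hQ using 1
    simp [polyFun, add_smul, Finset.sum_add_distrib]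
  | mul_X P j hP =>
    have : polyFun (P * MvPolynomial.X j) = fun y => polyFun P y * y j := by
      ext y; simp [polyFun]
    rw [this]
    convert! hP.mul (EuclideanSpace.proj (𝕜 := ℝ) j).hasFDerivAt using 1
    simp only [Derivation.leibniz, MvPolynomial.pderiv_X, polyFun, map_add, smul_eq_mul, map_mul,
      MvPolynomial.eval_X, add_smul, Finset.sum_add_distrib, PiLp.proj_apply, Finset.smul_sum,
      mul_smul]
    congr 1
    rw [Finset.sum_eq_single j]
    · simp
    · intro b _ hb
      simp [hb.symm]
    · simp

theorem gradient_polyFun {d : ℕ} (P : MvPolynomial (Fin d) ℝ) (x : Euc d) :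
    gradient (polyFun P) x =
      WithLp.toLp 2 fun i => polyFun (MvPolynomial.pderiv i P) x := by
  refine HasGradientAt.gradient ?_
  rw [hasGradientAt_iff_hasFDerivAt]
  convert! hasFDerivAt_polyFun P x using 1
  ext y
  simp [PiLp.inner_apply, mul_comm]

theorem totalDegree_pderiv_le {σ R : Type*} [CommSemiring R] (i : σ) (P : MvPolynomial σ R) :
    (MvPolynomial.pderiv i P).totalDegree ≤ P.totalDegree := by
  classical
  rw [P.as_sum, map_sum]
  refine (MvPolynomial.totalDegree_finsetSum _ _).trans (Finset.sup_le fun s hs => ?_)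
  rw [MvPolynomial.pderiv_monomial, ← P.as_sum]
  refine (MvPolynomial.totalDegree_monomial_le _ _).trans ?_
  refine le_trans ?_ (MvPolynomial.le_totalDegree hs)
  exact Finsupp.sum_le_sum_index (h := fun _ n => n) tsub_le_self (fun _ _ _ _ h => h)
    (fun _ _ => rfl)

/-- The restriction of a polynomial to the line `t ↦ y + t • w`. -/
noncomputable def lineRestrict {d : ℕ} (P : MvPolynomial (Fin d) ℝ) (y w : Euc d) :
    Polynomial ℝ :=
  MvPolynomial.aeval (fun i => Polynomial.C (y i) + Polynomial.X * Polynomial.C (w i)) P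

theorem eval_lineRestrict {d : ℕ} (P : MvPolynomial (Fin d) ℝ) (y w : Euc d) (t : ℝ) :
    (lineRestrict P y w).eval t = polyFun P (y + t • w) := by
  have : (Polynomial.evalRingHom t).comp (MvPolynomial.aeval
      (fun i => Polynomial.C (y i) + Polynomial.X * Polynomial.C (w i))).toRingHom =
      MvPolynomial.eval (fun i => (y + t • w) i) := by
    ext i
    · simp
    · simp [mul_comm t]
  exact congrArg (fun φ : MvPolynomial (Fin d) ℝ →+* ℝ => φ P) this

theorem natDegree_lineRestrict_le {d p : ℕ} {P : MvPolynomial (Fin d) ℝ}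
    (hP : P.totalDegree ≤ p) (y w : Euc d) : (lineRestrict P y w).natDegree ≤ p := by
  have := MvPolynomial.aeval_natDegree_le (n := 1) P hP
    (fun i => Polynomial.C (y i) + Polynomial.X * Polynomial.C (w i)) fun i => by
      refine Polynomial.natDegree_add_le_of_degree_le (by simp) ?_
      exact (Polynomial.natDegree_mul_C_le _ _).trans Polynomial.natDegree_X_le
  simpa [lineRestrict] using this

/-- The derivative of a polynomial function at `x` in the direction `x - y`. -/
noncomputable def radialDeriv {d : ℕ} (P : MvPolynomial (Fin d) ℝ) (y x : Euc d) : ℝ :=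
  ∑ i, polyFun (MvPolynomial.pderiv i P) x * (x i - y i)

theorem continuous_radialDeriv {d : ℕ} (P : MvPolynomial (Fin d) ℝ) (y : Euc d) :
    Continuous (radialDeriv P y) := by
  unfold radialDeriv
  refine continuous_finsetSum _ fun i _ => (continuous_polyFun _).mul ?_
  fun_prop

theorem eval_derivative_lineRestrict {d : ℕ} (P : MvPolynomial (Fin d) ℝ) (y w : Euc d) (t : ℝ) :
    t * (Polynomial.derivative (lineRestrict P y w)).eval t = radialDeriv P y (y + t • w) := by
  have h1 : HasDerivAt (fun s => (lineRestrict P y w).eval s)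
      (∑ i, polyFun (MvPolynomial.pderiv i P) (y + t • w) * w i) t := by
    simp only [eval_lineRestrict]
    have hl : HasDerivAt (fun s : ℝ => y + s • w) w t := by
      simpa using ((hasDerivAt_id t).smul_const w).const_add y
    have := (hasFDerivAt_polyFun P (y + t • w)).comp_hasDerivAt t hl
    convert! this using 1
    simp
  rw [(Polynomial.hasDerivAt _ t).unique h1, radialDeriv, Finset.mul_sum]
  refine Finset.sum_congr rfl fun i _ => ?_
  simp
  ring

/-! ### The Markov inequality in `L²` on convex bodies -/

theorem lintegral_Ioc_ofReal {F : ℝ → ℝ} (hF : Continuous F) {l : ℝ} (hl : 0 ≤ l)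
    (h0 : ∀ t, 0 ≤ t → 0 ≤ F t) :
    ∫⁻ t in Set.Ioc 0 l, ENNReal.ofReal (F t) = ENNReal.ofReal (∫ t in (0 : ℝ)..l, F t) := by
  rw [intervalIntegral.integral_of_le hl, ofReal_integral_eq_lintegral_ofReal]
  · exact (hF.integrableOn_Icc).mono_set Set.Ioc_subset_Icc_self
  · filter_upwards [ae_restrict_mem measurableSet_Ioc] with t ht using h0 t ht.1.le

/-- The Markov inequality on `(0, l]` with the weight `r ^ n`. -/
theorem lintegral_Ioc_markov (n p : ℕ) (hp : 1 ≤ p) {g : Polynomial ℝ} (hg : g.natDegree ≤ p)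
    {l : ℝ} (hl : 0 ≤ l) :
    ∫⁻ r in Set.Ioc 0 l,
        ENNReal.ofReal (r ^ n) * ENNReal.ofReal ((r * (Polynomial.derivative g).eval r) ^ 2) ≤
      ENNReal.ofReal (markovConst n * p ^ 4) *
        ∫⁻ r in Set.Ioc 0 l, ENNReal.ofReal (r ^ n) * ENNReal.ofReal (g.eval r ^ 2) := by
  have e1 : ∀ F : ℝ → ℝ, Continuous F →
      ∫⁻ r in Set.Ioc 0 l, ENNReal.ofReal (r ^ n) * ENNReal.ofReal (F r ^ 2) =
        ENNReal.ofReal (∫ r in (0 : ℝ)..l, r ^ n * F r ^ 2) := by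
    intro F hF
    rw [← lintegral_Ioc_ofReal (by fun_prop) hl fun t ht => by positivity]
    refine setLIntegral_congr_fun measurableSet_Ioc fun t ht => ?_
    exact (ENNReal.ofReal_mul (pow_nonneg ht.1.le n)).symm
  have e2 : ∀ F : ℝ → ℝ, ∫ r in (0 : ℝ)..l, r ^ n * F r ^ 2 =
      l ^ (n + 1) * ∫ t in (0 : ℝ)..1, t ^ n * F (l * t) ^ 2 := by
    intro F
    have := intervalIntegral.smul_integral_comp_mul_left (a := 0) (b := 1)
      (fun r => r ^ n * F r ^ 2) l
    simp only [mul_zero, mul_one, smul_eq_mul] at this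
    rw [← this, ← intervalIntegral.integral_const_mul, ← intervalIntegral.integral_const_mul]
    refine intervalIntegral.integral_congr fun t _ => ?_
    ring
  rw [e1 (fun r => r * _) (continuous_id.mul (Polynomial.continuous _)), e1 _ (Polynomial.continuous _),
    ← ENNReal.ofReal_mul (mul_nonneg (markovConst_pos n).le (by positivity))]
  refine ENNReal.ofReal_le_ofReal ?_
  rw [e2, e2]
  set q : Polynomial ℝ := g.comp (Polynomial.C l * Polynomial.X) with hq
  have hqd : q.natDegree ≤ p := by
    refine Polynomial.natDegree_comp_le.trans ?_
    calc _ ≤ g.natDegree * 1 :=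
          Nat.mul_le_mul_left _ ((Polynomial.natDegree_C_mul_le _ _).trans Polynomial.natDegree_X_le)
      _ ≤ p := by simpa using hg
  have h := unitIntegral_markov n p hp hqd
  have i1 : unitIntegral (Polynomial.X ^ n * (Polynomial.X * Polynomial.derivative q) ^ 2) =
      ∫ t in (0 : ℝ)..1, t ^ n * ((l * t) * (Polynomial.derivative g).eval (l * t)) ^ 2 := by
    refine intervalIntegral.integral_congr fun t _ => ?_
    simp only [hq, Polynomial.derivative_comp, Polynomial.eval_mul, Polynomial.eval_pow,
      Polynomial.eval_X, Polynomial.eval_comp, Polynomial.eval_C, Polynomial.derivative_mul,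
      Polynomial.derivative_C, Polynomial.derivative_X, Polynomial.eval_add, Polynomial.eval_zero,
      Polynomial.eval_one]
    ring
  have i2 : unitIntegral (Polynomial.X ^ n * q ^ 2) =
      ∫ t in (0 : ℝ)..1, t ^ n * (g.eval (l * t)) ^ 2 := by
    refine intervalIntegral.integral_congr fun t _ => ?_
    simp [hq]
  rw [i1, i2] at h
  calc _ ≤ l ^ (n + 1) * _ := mul_le_mul_of_nonneg_left h (by positivity)
    _ = _ := by ring

/-- The trace inequality at the end point `1` of `(0, 1]` with the weight `t ^ n`. -/
theorem ofReal_eval_one_sq_le (n p : ℕ) (hp : 1 ≤ p) {g : Polynomial ℝ} (hg : g.natDegree ≤ p) :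
    ENNReal.ofReal (g.eval 1 ^ 2) ≤ ENNReal.ofReal (traceConst n * p ^ 2) *
        ∫⁻ t in Set.Ioc 0 1, ENNReal.ofReal (t ^ n) * ENNReal.ofReal (g.eval t ^ 2) := by
  have e1 : ∫⁻ t in Set.Ioc 0 1, ENNReal.ofReal (t ^ n) * ENNReal.ofReal (g.eval t ^ 2) =
        ENNReal.ofReal (unitIntegral (Polynomial.X ^ n * g ^ 2)) := by
    rw [show unitIntegral (Polynomial.X ^ n * g ^ 2) =
      ∫ t in (0 : ℝ)..1, t ^ n * g.eval t ^ 2 from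
        intervalIntegral.integral_congr fun t _ => by simp]
    rw [← lintegral_Ioc_ofReal (by fun_prop) zero_le_one fun t ht => by positivity]
    refine setLIntegral_congr_fun measurableSet_Ioc fun t ht => ?_
    exact (ENNReal.ofReal_mul (pow_nonneg ht.1.le n)).symm
  rw [e1, ← ENNReal.ofReal_mul (mul_nonneg (traceConst_pos n).le (by positivity))]
  exact ENNReal.ofReal_le_ofReal (eval_one_sq_le n p hp hg)

/-- Integration in polar coordinates. -/
theorem lintegral_polar {n : ℕ} {f : Euc (n + 1) → ℝ≥0∞} (hf : Measurable f) :
    ∫⁻ x, f x = ∫⁻ θ, (∫⁻ r in Set.Ioi (0 : ℝ), ENNReal.ofReal (r ^ n) * f (r • θ.1))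
      ∂(volume : Measure (Euc (n + 1))).toSphere := by
  have hmp := (volume : Measure (Euc (n + 1))).measurePreserving_homeomorphUnitSphereProd
  rw [finrank_euclideanSpace_fin, Nat.add_sub_cancel] at hmp
  have h1 : ∫⁻ x, f x = ∫⁻ x : ({0}ᶜ : Set (Euc (n + 1))), f x
      ∂(Measure.comap Subtype.val volume) := by
    rw [lintegral_subtype_comap (measurableSet_singleton _).compl, restrict_compl_singleton]
  have h2 := hmp.lintegral_comp_emb (Homeomorph.measurableEmbedding _)
    (fun z => f (z.2.1 • z.1.1))
  have h3 : ∀ x : ({0}ᶜ : Set (Euc (n + 1))),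
      ((homeomorphUnitSphereProd (Euc (n + 1)) x).2.1 •
        (homeomorphUnitSphereProd (Euc (n + 1)) x).1.1) = x.1 := fun x => by
    have := (homeomorphUnitSphereProd (Euc (n + 1))).symm_apply_apply x
    rw [← homeomorphUnitSphereProd_symm_apply_coe, this]
  simp only [h3] at h2
  have hm : Measurable fun z : Metric.sphere (0 : Euc (n + 1)) 1 × Set.Ioi (0 : ℝ) =>
      f (z.2.1 • z.1.1) := hf.comp (by fun_prop)
  rw [h1, h2, lintegral_prod _ hm.aemeasurable]
  refine lintegral_congr fun θ => ?_
  have hm' : Measurable fun r : Set.Ioi (0 : ℝ) => f (r.1 • θ.1) := hf.comp (by fun_prop)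
  rw [Measure.volumeIoiPow, lintegral_withDensity_eq_lintegral_mul _ (by fun_prop) hm',
    ← lintegral_subtype_comap measurableSet_Ioi]
  rfl

/-- On a convex body `S`, the derivative in the direction of the rays from a point `y` of `S` is
bounded by the function itself, with a constant that does not depend on `S`. -/
theorem lintegral_radialDeriv_sq_le {n p : ℕ} (hp : 1 ≤ p) {S : Set (Euc (n + 1))}
    (hS : IsCompact S) (hc : Convex ℝ S) {y : Euc (n + 1)} (hy : y ∈ S)
    {P : MvPolynomial (Fin (n + 1)) ℝ} (hP : P.totalDegree ≤ p) :
    ∫⁻ x in S, ENNReal.ofReal (radialDeriv P y x ^ 2) ≤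
      ENNReal.ofReal (markovConst n * p ^ 4) * ∫⁻ x in S, ENNReal.ofReal (polyFun P x ^ 2) := by
  have hSm := hS.isClosed.measurableSet
  have key : ∀ F : Euc (n + 1) → ℝ, Continuous F → ∫⁻ x in S, ENNReal.ofReal (F x) =
      ∫⁻ θ, (∫⁻ r in Set.Ioi (0 : ℝ), ENNReal.ofReal (r ^ n) *
        S.indicator (fun x => ENNReal.ofReal (F x)) (y + r • θ.1))
        ∂(volume : Measure (Euc (n + 1))).toSphere := by
    intro F hF
    have hm : Measurable (S.indicator fun x => ENNReal.ofReal (F x)) :=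
      hF.measurable.ennreal_ofReal.indicator hSm
    rw [← lintegral_indicator hSm, ← lintegral_add_left_eq_self _ y]
    exact lintegral_polar (hm.comp (measurable_const_add y))
  rw [key (fun x => radialDeriv P y x ^ 2) ((continuous_radialDeriv P y).pow 2),
    key (fun x => polyFun P x ^ 2) ((continuous_polyFun P).pow 2),
    ← lintegral_const_mul' _ _ ENNReal.ofReal_ne_top]
  refine lintegral_mono fun θ => ?_
  -- the ray from `y` in the direction `θ` meets `S` in a segment
  obtain ⟨l, hl0, hl⟩ : ∃ l : ℝ, 0 ≤ l ∧ ∀ r, 0 < r → (y + r • θ.1 ∈ S ↔ r ≤ l) := by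
    have hθ : ‖θ.1‖ = 1 := by simp
    let R : Set ℝ := {r | 0 ≤ r ∧ y + r • θ.1 ∈ S}
    have hR0 : (0 : ℝ) ∈ R := ⟨le_rfl, by simpa using hy⟩
    have hRc : IsClosed R := isClosed_Ici.inter (hS.isClosed.preimage (by fun_prop))
    obtain ⟨B, hB⟩ := hS.isBounded.subset_closedBall y
    have hRb : BddAbove R := ⟨B, fun r hr => by
      have := hB hr.2
      simpa [hθ, norm_smul, abs_of_nonneg hr.1] using this⟩
    refine ⟨sSup R, le_csSup hRb hR0, fun r hr => ⟨fun h => le_csSup hRb ⟨hr.le, h⟩, fun h => ?_⟩⟩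
    have hmem := (hRc.csSup_mem ⟨0, hR0⟩ hRb).2
    have hpos : 0 < sSup R := hr.trans_le h
    have := hc.add_smul_sub_mem hy hmem (t := r / sSup R)
      ⟨by positivity, (div_le_one hpos).2 h⟩
    simpa [smul_smul, div_mul_cancel₀ _ hpos.ne'] using this
  have hray : ∀ F : Euc (n + 1) → ℝ, ∫⁻ r in Set.Ioi (0 : ℝ), ENNReal.ofReal (r ^ n) *
        S.indicator (fun x => ENNReal.ofReal (F x)) (y + r • θ.1) =
      ∫⁻ r in Set.Ioc 0 l, ENNReal.ofReal (r ^ n) * ENNReal.ofReal (F (y + r • θ.1)) := by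
    intro F
    rw [← lintegral_indicator measurableSet_Ioi, ← lintegral_indicator measurableSet_Ioc]
    refine lintegral_congr fun r => ?_
    by_cases hr : 0 < r
    · by_cases hrl : r ≤ l
      · simp [hr, hrl, (hl r hr).2 hrl]
      · simp [hr, hrl, mt (hl r hr).1 hrl]
    · simp [hr]
  rw [hray, hray]
  have := lintegral_Ioc_markov n p hp (natDegree_lineRestrict_le hP y θ.1) hl0
  simpa only [eval_lineRestrict, eval_derivative_lineRestrict] using this

/-- The Markov inequality in `L²` on a convex body that contains a ball of radius `r`: the radial
derivatives with respect to the centre `z` and to `z + r eᵢ` differ by `r ∂ᵢ`. -/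
theorem lintegral_pderiv_sq_le {n p : ℕ} (hp : 1 ≤ p) {S : Set (Euc (n + 1))}
    (hS : IsCompact S) (hc : Convex ℝ S) {z : Euc (n + 1)} {r : ℝ} (hr : 0 < r)
    (hball : Metric.closedBall z r ⊆ S)
    {P : MvPolynomial (Fin (n + 1)) ℝ} (hP : P.totalDegree ≤ p) (i : Fin (n + 1)) :
    ∫⁻ x in S, ENNReal.ofReal (polyFun (MvPolynomial.pderiv i P) x ^ 2) ≤
      ENNReal.ofReal (4 * markovConst n * p ^ 4 / r ^ 2) *
        ∫⁻ x in S, ENNReal.ofReal (polyFun P x ^ 2) := by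
  have hz : z ∈ S := hball (Metric.mem_closedBall_self hr.le)
  set y : Euc (n + 1) := z + r • EuclideanSpace.single i (1 : ℝ) with hy
  have hyS : y ∈ S := hball (by simp [hy, norm_smul, abs_of_pos hr])
  have hdiff : ∀ x, radialDeriv P z x - radialDeriv P y x =
      r * polyFun (MvPolynomial.pderiv i P) x := by
    intro x
    rw [radialDeriv, radialDeriv, ← Finset.sum_sub_distrib, Finset.sum_eq_single i]
    · simp [hy]; ring
    · intro j _ hj
      simp [hy, hj]
    · simp
  have hpt : ∀ x, ENNReal.ofReal (polyFun (MvPolynomial.pderiv i P) x ^ 2) ≤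
      ENNReal.ofReal (2 / r ^ 2) * (ENNReal.ofReal (radialDeriv P z x ^ 2) +
        ENNReal.ofReal (radialDeriv P y x ^ 2)) := by
    intro x
    rw [← ENNReal.ofReal_add (sq_nonneg _) (sq_nonneg _), ← ENNReal.ofReal_mul (by positivity)]
    refine ENNReal.ofReal_le_ofReal ?_
    rw [div_mul_eq_mul_div, le_div_iff₀ (by positivity)]
    have := hdiff x
    have e : polyFun (MvPolynomial.pderiv i P) x ^ 2 * r ^ 2 =
        (radialDeriv P z x - radialDeriv P y x) ^ 2 := by rw [this]; ring
    rw [e]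
    nlinarith [sq_nonneg (radialDeriv P z x + radialDeriv P y x)]
  calc _ ≤ ∫⁻ x in S, ENNReal.ofReal (2 / r ^ 2) * (ENNReal.ofReal (radialDeriv P z x ^ 2) +
        ENNReal.ofReal (radialDeriv P y x ^ 2)) := lintegral_mono hpt
    _ = ENNReal.ofReal (2 / r ^ 2) * ((∫⁻ x in S, ENNReal.ofReal (radialDeriv P z x ^ 2)) +
        ∫⁻ x in S, ENNReal.ofReal (radialDeriv P y x ^ 2)) := by
      rw [lintegral_const_mul' _ _ ENNReal.ofReal_ne_top, lintegral_add_left]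
      exact ((continuous_radialDeriv P z).pow 2 :).measurable.ennreal_ofReal
    _ ≤ ENNReal.ofReal (2 / r ^ 2) * (ENNReal.ofReal (markovConst n * p ^ 4) *
          (∫⁻ x in S, ENNReal.ofReal (polyFun P x ^ 2)) +
        ENNReal.ofReal (markovConst n * p ^ 4) *
          ∫⁻ x in S, ENNReal.ofReal (polyFun P x ^ 2)) := by
      gcongr
      · exact lintegral_radialDeriv_sq_le hp hS hc hz hP
      · exact lintegral_radialDeriv_sq_le hp hS hc hyS hP
    _ = _ := by
      have hK := (markovConst_pos n).le
      generalize (∫⁻ x in S, ENNReal.ofReal (polyFun P x ^ 2)) = J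
      rw [← two_mul, ← mul_assoc, ← mul_assoc, ← ENNReal.ofReal_ofNat 2,
        ← ENNReal.ofReal_mul (by positivity), ← ENNReal.ofReal_mul (by positivity)]
      congr 2
      ring

/-! ### The trace inequality on simplices -/

theorem lintegral_comp_pos_smul {E : Type*} [NormedAddCommGroup E] [NormedSpace ℝ E]
    [MeasurableSpace E] [BorelSpace E] [FiniteDimensional ℝ E] (μ : Measure E)
    [μ.IsAddHaarMeasure] (f : E → ℝ≥0∞) {r : ℝ} (hr : 0 < r) :
    ENNReal.ofReal (r ^ Module.finrank ℝ E) * ∫⁻ x, f (r • x) ∂μ = ∫⁻ x, f x ∂μ := by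
  have h1 : ∫⁻ x, f (r • x) ∂μ = ∫⁻ x, f x ∂(μ.map (r • ·)) :=
    ((Homeomorph.smulOfNeZero r hr.ne').measurableEmbedding.lintegral_map f).symm
  rw [h1, Measure.map_addHaar_smul μ hr.ne', lintegral_smul_measure, smul_eq_mul, ← mul_assoc,
    ← ENNReal.ofReal_mul (by positivity), abs_of_pos (by positivity),
    mul_inv_cancel₀ (by positivity), ENNReal.ofReal_one, one_mul]

section Hyperplane

variable {n : ℕ} {ν : Euc (n + 1)}

theorem finrank_normal_orthogonal (hν : ‖ν‖ = 1) :
    Module.finrank ℝ ((ℝ ∙ ν)ᗮ : Submodule ℝ (Euc (n + 1))) = n := by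
  have : Fact (Module.finrank ℝ (Euc (n + 1)) = n + 1) := ⟨finrank_euclideanSpace_fin⟩
  exact Submodule.finrank_orthogonal_span_singleton (n := n) (norm_ne_zero_iff.1 (by simp [hν]))

/-- Fubini's theorem for the hyperplanes orthogonal to a unit vector `ν`. -/
theorem lintegral_eq_lintegral_hyperplanes (hν : ‖ν‖ = 1) (z : Euc (n + 1))
    {f : Euc (n + 1) → ℝ≥0∞} (hf : Measurable f) :
    ∫⁻ x, f x = ∫⁻ τ : ℝ, ∫⁻ y : ((ℝ ∙ ν)ᗮ : Submodule ℝ (Euc (n + 1))), f (z + τ • ν + y) := by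
  have h1 := (ℝ ∙ ν).measurePreserving_measurableEquivProd z
  rw [InnerProductSpace.euclideanHausdorffMeasure_eq_volume] at h1
  have hm : Measurable fun q => f (((ℝ ∙ ν).measurableEquivProd z).symm q) :=
    hf.comp (MeasurableEquiv.measurable _)
  rw [← h1.symm.lintegral_comp hf, Measure.volume_eq_prod, lintegral_prod _ hm.aemeasurable]
  rw [← (LinearIsometryEquiv.toSpanUnitSingleton ν hν).measurePreserving.lintegral_comp]
  · refine lintegral_congr fun τ => lintegral_congr fun y => ?_
    simp
    congr 1
    abel
  · exact hm.lintegral_prod_right'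

/-- On subsets of a hyperplane orthogonal to `ν`, the surface measure is the Lebesgue measure of
the hyperplane. -/
theorem setLIntegral_surf_hyperplane (hν : ‖ν‖ = 1) (z : Euc (n + 1)) (ρ : ℝ)
    {G : Set (Euc (n + 1))} (hG : MeasurableSet G) (hGν : ∀ x ∈ G, inner ℝ (x - z) ν = ρ)
    (f : Euc (n + 1) → ℝ≥0∞) :
    ∫⁻ x in G, f x ∂(surf (n + 1)) =
      ∫⁻ y : ((ℝ ∙ ν)ᗮ : Submodule ℝ (Euc (n + 1))), G.indicator f (z + ρ • ν + y) := by
  let φ : ((ℝ ∙ ν)ᗮ : Submodule ℝ (Euc (n + 1))) → Euc (n + 1) := fun y => z + ρ • ν + y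
  have hφ : Isometry φ := Isometry.of_dist_eq fun a b => by simp [φ, Subtype.dist_eq]
  have hvol : (volume : Measure ((ℝ ∙ ν)ᗮ : Submodule ℝ (Euc (n + 1)))) =
      Measure.euclideanHausdorffMeasure n := by
    rw [← InnerProductSpace.euclideanHausdorffMeasure_eq_volume, finrank_normal_orthogonal hν]
  have hmap := hφ.map_euclideanHausdorffMeasure (d := n)
  have hrange : G ⊆ Set.range φ := fun x hx => by
    refine ⟨⟨x - z - ρ • ν, ?_⟩, by simp [φ]⟩
    rw [Submodule.mem_orthogonal_singleton_iff_inner_left, inner_sub_left, hGν x hx,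
      inner_smul_left, real_inner_self_eq_norm_sq, hν]
    simp
  have h2 : ∫⁻ y, G.indicator f (φ y) = ∫⁻ x, G.indicator f x ∂(volume.map φ) :=
    (hφ.isClosedEmbedding.measurableEmbedding.lintegral_map _).symm
  change _ = ∫⁻ y, G.indicator f (φ y)
  rw [h2, hvol, hmap, lintegral_indicator hG, Measure.restrict_restrict hG,
    Set.inter_eq_left.2 hrange]
  simp [surf]

/-- The cone with apex `z` over a subset `G` of a hyperplane at distance `ρ` from `z`: an integral
over `G` of integrals along the rays from `z` is bounded by the integral over any convex set
containing the cone. -/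
theorem lintegral_cone_le (hν : ‖ν‖ = 1) {z : Euc (n + 1)} {ρ : ℝ} (hρ : 0 < ρ)
    {S : Set (Euc (n + 1))} (hS : MeasurableSet S) (hc : Convex ℝ S) (hz : z ∈ S)
    {G : Set (Euc (n + 1))} (hG : MeasurableSet G) (hGS : G ⊆ S)
    (hGν : ∀ x ∈ G, inner ℝ (x - z) ν = ρ) {f : Euc (n + 1) → ℝ≥0∞} (hf : Measurable f) :
    ENNReal.ofReal ρ * ∫⁻ x in G, (∫⁻ t in Set.Ioc (0 : ℝ) 1,
      ENNReal.ofReal (t ^ n) * f (z + t • (x - z))) ∂(surf (n + 1)) ≤ ∫⁻ x in S, f x := by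
  set K : Submodule ℝ (Euc (n + 1)) := (ℝ ∙ ν)ᗮ with hK
  set g := S.indicator f with hg
  have hgm : Measurable g := hf.indicator hS
  rw [setLIntegral_surf_hyperplane hν z ρ hG hGν]
  have h1 : ∀ y : K, G.indicator (fun x => ∫⁻ t in Set.Ioc (0 : ℝ) 1,
      ENNReal.ofReal (t ^ n) * f (z + t • (x - z))) (z + ρ • ν + y) ≤
      ∫⁻ t in Set.Ioc (0 : ℝ) 1, ENNReal.ofReal (t ^ n) * g (z + (t * ρ) • ν + t • (y : Euc (n + 1))) := by
    intro y
    by_cases hy : z + ρ • ν + y ∈ G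
    · rw [Set.indicator_of_mem hy]
      refine setLIntegral_mono_ae' measurableSet_Ioc (.of_forall fun t ht => ?_)
      have e : z + t • (z + ρ • ν + (y : Euc (n + 1)) - z) =
          z + (t * ρ) • ν + t • (y : Euc (n + 1)) := by
        module
      have hm : z + t • (z + ρ • ν + (y : Euc (n + 1)) - z) ∈ S :=
        hc.add_smul_sub_mem hz (hGS hy) ⟨ht.1.le, ht.2⟩
      rw [e] at hm ⊢
      rw [hg, Set.indicator_of_mem hm]
    · rw [Set.indicator_of_notMem hy]
      exact zero_le
  have hm2 : Measurable fun q : K × ℝ =>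
      ENNReal.ofReal (q.2 ^ n) * g (z + (q.2 * ρ) • ν + q.2 • (q.1 : Euc (n + 1))) := by
    refine Measurable.mul (by fun_prop) (hgm.comp ?_)
    fun_prop
  have h2 : ∀ t ∈ Set.Ioc (0 : ℝ) 1,
      ∫⁻ y : K, ENNReal.ofReal (t ^ n) * g (z + (t * ρ) • ν + t • (y : Euc (n + 1))) =
        ∫⁻ y : K, g (z + (t * ρ) • ν + y) := by
    intro t ht
    have := lintegral_comp_pos_smul (volume : Measure K)
      (fun y => g (z + (t * ρ) • ν + (y : Euc (n + 1)))) ht.1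
    rw [finrank_normal_orthogonal hν] at this
    rw [← this, lintegral_const_mul' _ _ ENNReal.ofReal_ne_top]
    rfl
  calc
    _ ≤ ENNReal.ofReal ρ * ∫⁻ y : K, (∫⁻ t in Set.Ioc (0 : ℝ) 1,
        ENNReal.ofReal (t ^ n) * g (z + (t * ρ) • ν + t • (y : Euc (n + 1)))) := by
      gcongr
      exact h1 _
    _ = ENNReal.ofReal ρ * ∫⁻ t in Set.Ioc (0 : ℝ) 1, ∫⁻ y : K,
        ENNReal.ofReal (t ^ n) * g (z + (t * ρ) • ν + t • (y : Euc (n + 1))) := by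
      rw [lintegral_lintegral_swap hm2.aemeasurable]
    _ = ENNReal.ofReal ρ * ∫⁻ t in Set.Ioc (0 : ℝ) 1, ∫⁻ y : K, g (z + (t * ρ) • ν + y) := by
      rw [setLIntegral_congr_fun measurableSet_Ioc h2]
    _ ≤ ENNReal.ofReal ρ * ∫⁻ t : ℝ, ∫⁻ y : K, g (z + (t * ρ) • ν + y) := by
      gcongr
      exact Measure.restrict_le_self
    _ = ∫⁻ τ : ℝ, ∫⁻ y : K, g (z + τ • ν + y) := by
      rw [← lintegral_comp_pos_smul (volume : Measure ℝ)
        (fun τ => ∫⁻ y : K, g (z + τ • ν + y)) hρ]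
      simp [mul_comm ρ]
    _ = ∫⁻ x in S, f x := by
      rw [← lintegral_eq_lintegral_hyperplanes hν z hgm, hg, lintegral_indicator hS]

/-- The trace inequality on a subset of a hyperplane at distance `ρ` from a point `z` of a convex
set: apply the one-dimensional trace inequality on every ray from `z`. -/
theorem setLIntegral_surf_polyFun_sq_le {p : ℕ} (hp : 1 ≤ p) (hν : ‖ν‖ = 1) {z : Euc (n + 1)}
    {ρ : ℝ} (hρ : 0 < ρ) {S : Set (Euc (n + 1))} (hS : MeasurableSet S) (hc : Convex ℝ S)
    (hz : z ∈ S) {G : Set (Euc (n + 1))} (hG : MeasurableSet G) (hGS : G ⊆ S)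
    (hGν : ∀ x ∈ G, inner ℝ (x - z) ν = ρ) {P : MvPolynomial (Fin (n + 1)) ℝ}
    (hP : P.totalDegree ≤ p) :
    ∫⁻ x in G, ENNReal.ofReal (polyFun P x ^ 2) ∂(surf (n + 1)) ≤
      ENNReal.ofReal (traceConst n * p ^ 2 / ρ) * ∫⁻ x in S, ENNReal.ofReal (polyFun P x ^ 2) := by
  have hf : Measurable fun x => ENNReal.ofReal (polyFun P x ^ 2) :=
    ((continuous_polyFun P).pow 2 :).measurable.ennreal_ofReal
  have h := lintegral_cone_le hν hρ hS hc hz hG hGS hGν hf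
  have h1 : ∀ x, ENNReal.ofReal (polyFun P x ^ 2) ≤ ENNReal.ofReal (traceConst n * p ^ 2) *
      ∫⁻ t in Set.Ioc (0 : ℝ) 1,
        ENNReal.ofReal (t ^ n) * ENNReal.ofReal (polyFun P (z + t • (x - z)) ^ 2) := by
    intro x
    have := ofReal_eval_one_sq_le n p hp (natDegree_lineRestrict_le hP z (x - z))
    simpa [eval_lineRestrict] using this
  have hT := (traceConst_pos n).le
  calc _ ≤ ∫⁻ x in G, ENNReal.ofReal (traceConst n * p ^ 2) * (∫⁻ t in Set.Ioc (0 : ℝ) 1,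
        ENNReal.ofReal (t ^ n) * ENNReal.ofReal (polyFun P (z + t • (x - z)) ^ 2))
          ∂(surf (n + 1)) := lintegral_mono h1
    _ = ENNReal.ofReal (traceConst n * p ^ 2 / ρ) * (ENNReal.ofReal ρ *
        ∫⁻ x in G, (∫⁻ t in Set.Ioc (0 : ℝ) 1,
        ENNReal.ofReal (t ^ n) * ENNReal.ofReal (polyFun P (z + t • (x - z)) ^ 2))
          ∂(surf (n + 1))) := by
      rw [lintegral_const_mul' _ _ ENNReal.ofReal_ne_top, ← mul_assoc,
        ← ENNReal.ofReal_mul (by positivity), div_mul_cancel₀ _ hρ.ne']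
    _ ≤ _ := by gcongr

end Hyperplane

theorem IsSimplex.isCompact {d n : ℕ} {S : Set (Euc d)} (hS : IsSimplex n S) : IsCompact S := by
  obtain ⟨s, rfl⟩ := hS
  exact (Set.finite_range _).isCompact_convexHull (𝕜 := ℝ)

theorem IsSimplex.convex {d n : ℕ} {S : Set (Euc d)} (hS : IsSimplex n S) : Convex ℝ S := by
  obtain ⟨s, rfl⟩ := hS
  exact convex_convexHull ℝ _

/-- The boundary of a full-dimensional simplex that contains a ball with centre `z` and radius `r`
is covered by `d + 1` facets, each in a hyperplane at distance at least `r` from `z`. -/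
theorem IsSimplex.frontier_subset {d : ℕ} [NeZero d] {S : Set (Euc d)} (hS : IsSimplex d S)
    {z : Euc d} {r : ℝ} (hr : 0 < r) (hball : Metric.closedBall z r ⊆ S) :
    ∃ (ν : Fin (d + 1) → Euc d) (ρ : Fin (d + 1) → ℝ), (∀ i, ‖ν i‖ = 1) ∧ (∀ i, r ≤ ρ i) ∧
      frontier S ⊆ ⋃ i, S ∩ {x | inner ℝ (x - z) (ν i) = ρ i} := by
  have hSc := hS.isCompact.isClosed
  obtain ⟨s, hs⟩ := hS
  let b : AffineBasis (Fin (d + 1)) ℝ (Euc d) := ⟨s.points, s.independent, by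
    rw [s.independent.affineSpan_eq_top_iff_card_eq_finrank_add_one]
    simp⟩
  have hb : S = convexHull ℝ (Set.range b) := hs
  have hnonneg : ∀ x, x ∈ S ↔ ∀ i, 0 ≤ b.coord i x := fun x => by
    rw [hb, b.convexHull_eq_nonneg_coord]; rfl
  have hint : ∀ x, x ∈ interior S ↔ ∀ i, 0 < b.coord i x := fun x => by
    rw [hb, b.interior_convexHull]; rfl
  have hfront : frontier S ⊆ ⋃ i, S ∩ {x | b.coord i x = 0} := by
    intro x hx
    rw [hSc.frontier_eq] at hx
    have h1 := mt (hint x).2 hx.2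
    push Not at h1
    obtain ⟨i, hi⟩ := h1
    exact Set.mem_iUnion.2 ⟨i, hx.1, le_antisymm hi ((hnonneg x).1 hx.1 i)⟩
  have key : ∀ i, ∃ (ν : Euc d) (ρ : ℝ), ‖ν‖ = 1 ∧ r ≤ ρ ∧
      ∀ x, b.coord i x = 0 → inner ℝ (x - z) ν = ρ := by
    intro i
    let w : Euc d := (InnerProductSpace.toDual ℝ (Euc d)).symm
      (LinearMap.toContinuousLinearMap (b.coord i).linear)
    have hw : ∀ x, b.coord i x = b.coord i z + inner ℝ w (x - z) := fun x => by
      have h1 : inner ℝ w (x - z) = (b.coord i).linear (x - z) := by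
        simp [w]
      have h2 := (b.coord i).linearMap_vsub x z
      simp only [vsub_eq_sub] at h2
      rw [h1, h2]; ring
    have hw0 : w ≠ 0 := by
      intro h0
      have : Nontrivial (Fin (d + 1)) := Fin.nontrivial_iff_two_le.2 (by
        have := NeZero.pos d
        omega)
      obtain ⟨j, hj⟩ := exists_ne i
      have h1 := hw (b i)
      have h2 := hw (b j)
      rw [h0, inner_zero_left, b.coord_apply_eq] at h1
      rw [h0, inner_zero_left, b.coord_apply_ne hj.symm] at h2
      linarith
    have hn : 0 < ‖w‖ := norm_pos_iff.2 hw0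
    refine ⟨-(‖w‖⁻¹ • w), b.coord i z / ‖w‖, ?_, ?_, fun x hx => ?_⟩
    · rw [norm_neg, norm_smul, norm_inv, norm_norm, inv_mul_cancel₀ hn.ne']
    · have hm : z - (r * ‖w‖⁻¹) • w ∈ S := hball (by
        rw [Metric.mem_closedBall, dist_eq_norm]
        simp [norm_smul, abs_of_pos hr, inv_mul_cancel_right₀ hn.ne'])
      have h3 := (hnonneg _).1 hm i
      rw [hw, sub_sub_cancel_left, inner_neg_right, inner_smul_right,
        real_inner_self_eq_norm_sq] at h3
      rw [le_div_iff₀ hn]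
      have : r * ‖w‖⁻¹ * ‖w‖ ^ 2 = r * ‖w‖ := by field_simp
      linarith
    · rw [hw] at hx
      rw [inner_neg_right, inner_smul_right, real_inner_comm, eq_div_iff hn.ne']
      field_simp
      linarith
  choose ν ρ h1 h2 h3 using key
  refine ⟨ν, ρ, h1, h2, hfront.trans (Set.iUnion_mono fun i x hx => ⟨hx.1, h3 i x hx.2⟩)⟩

/-- The trace inequality on the boundary of a simplex containing a ball of radius `r`. -/
theorem IsSimplex.lintegral_frontier_sq_le {n p : ℕ} (hp : 1 ≤ p) {S : Set (Euc (n + 1))}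
    (hS : IsSimplex (n + 1) S) {z : Euc (n + 1)} {r : ℝ} (hr : 0 < r)
    (hball : Metric.closedBall z r ⊆ S) {P : MvPolynomial (Fin (n + 1)) ℝ}
    (hP : P.totalDegree ≤ p) :
    ∫⁻ x in frontier S, ENNReal.ofReal (polyFun P x ^ 2) ∂(surf (n + 1)) ≤
      ENNReal.ofReal ((n + 2) * traceConst n * p ^ 2 / r) *
        ∫⁻ x in S, ENNReal.ofReal (polyFun P x ^ 2) := by
  obtain ⟨ν, ρ, hν, hρ, hsub⟩ := hS.frontier_subset hr hball
  have hSm := hS.isCompact.isClosed.measurableSet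
  have hT := (traceConst_pos n).le
  have hGm : ∀ i, MeasurableSet (S ∩ {x | inner ℝ (x - z) (ν i) = ρ i}) := fun i =>
    hSm.inter (isClosed_eq (by fun_prop) continuous_const).measurableSet
  calc _ ≤ ∫⁻ x in ⋃ i, S ∩ {x | inner ℝ (x - z) (ν i) = ρ i},
        ENNReal.ofReal (polyFun P x ^ 2) ∂(surf (n + 1)) := lintegral_mono_set hsub
    _ ≤ ∑' i, ∫⁻ x in S ∩ {x | inner ℝ (x - z) (ν i) = ρ i},
        ENNReal.ofReal (polyFun P x ^ 2) ∂(surf (n + 1)) := lintegral_iUnion_le _ _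
    _ = ∑ i, ∫⁻ x in S ∩ {x | inner ℝ (x - z) (ν i) = ρ i},
        ENNReal.ofReal (polyFun P x ^ 2) ∂(surf (n + 1)) := tsum_fintype _
    _ ≤ ∑ i : Fin (n + 1 + 1), ENNReal.ofReal (traceConst n * p ^ 2 / r) *
        ∫⁻ x in S, ENNReal.ofReal (polyFun P x ^ 2) := by
      refine Finset.sum_le_sum fun i _ => ?_
      refine (setLIntegral_surf_polyFun_sq_le hp (hν i) (hr.trans_le (hρ i)) hSm hS.convex
        (hball (Metric.mem_closedBall_self hr.le)) (hGm i) Set.inter_subset_left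
        (fun x hx => hx.2) hP).trans ?_
      gcongr
      exact hρ i
    _ = _ := by
      rw [Finset.sum_const, Finset.card_univ, Fintype.card_fin, nsmul_eq_mul, ← mul_assoc,
        ← ENNReal.ofReal_natCast, ← ENNReal.ofReal_mul (by positivity)]
      congr 2
      push_cast
      ring

/-! ### Inverse and trace inequalities on the elements -/

theorem setLIntegral_biUnion_finset_le {α β : Type*} {m : MeasurableSpace α} (μ : Measure α)
    (s : Finset β) (t : β → Set α) (f : α → ℝ≥0∞) :
    ∫⁻ x in ⋃ b ∈ s, t b, f x ∂μ ≤ ∑ b ∈ s, ∫⁻ x in t b, f x ∂μ := by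
  classical
  induction s using Finset.induction_on with
  | empty => simp
  | insert a s ha ih =>
    rw [Finset.set_biUnion_insert, Finset.sum_insert ha]
    exact (lintegral_union_le _ _ _).trans (by gcongr)

/-- A simplex whose volume is comparable to `h ^ d` and whose diameter is at most `γ r` satisfies
`h ≲ γ r`, since its volume is at most that of a ball of radius `γ r`. -/
theorem mul_le_of_vol_ge {d : ℕ} (hd : d ≠ 0) {S : Set (Euc d)} (hS : Bornology.IsBounded S)
    (hne : S.Nonempty) {c h ρ : ℝ} (hh : 0 ≤ h) (hρ : Metric.diam S ≤ ρ)
    (hc : 0 < c) (hvol : c * h ^ d ≤ vol S) :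
    min 1 (c / vol (Metric.ball (0 : Euc d) 1)) * h ≤ ρ := by
  set V := vol (Metric.ball (0 : Euc d) 1) with hV
  have hVpos : 0 < V := ENNReal.toReal_pos (Metric.measure_ball_pos _ _ one_pos).ne'
    measure_ball_lt_top.ne
  obtain ⟨x, hx⟩ := hne
  have hρ0 : 0 ≤ ρ := Metric.diam_nonneg.trans hρ
  have hsub : S ⊆ Metric.closedBall x ρ := fun y hy =>
    (Metric.dist_le_diam_of_mem hS hy hx).trans hρ
  have h1 : vol S ≤ ρ ^ d * V := by
    have := measureReal_mono (μ := (volume : Measure (Euc d))) hsub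
      measure_closedBall_lt_top.ne
    refine this.trans_eq ?_
    rw [measureReal_def, Measure.addHaar_closedBall _ _ hρ0, ENNReal.toReal_mul,
      ENNReal.toReal_ofReal (by positivity), finrank_euclideanSpace_fin]
    rfl
  set θ := min 1 (c / V) with hθ
  have hθ0 : 0 < θ := lt_min one_pos (by positivity)
  rw [← pow_le_pow_iff_left₀ (by positivity) hρ0 hd]
  calc (θ * h) ^ d = θ ^ d * h ^ d := mul_pow _ _ _
    _ ≤ θ * h ^ d := by
      gcongr
      exact pow_le_of_le_one hθ0.le (min_le_left _ _) hd
    _ ≤ c / V * h ^ d := by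
      gcongr
      exact min_le_right _ _
    _ = c * h ^ d / V := by ring
    _ ≤ ρ ^ d := by
      rw [div_le_iff₀ hVpos]
      exact hvol.trans h1

section Subtriangulation

section

variable {d : ℕ} {κ : Set (Euc d)} {𝒮 : Finset (Set (Euc d))}

theorem sum_setLIntegral_le (hκ : interior (closure κ) = κ) (hS : ∀ S ∈ 𝒮, IsSimplex d S)
    (hdisj : ∀ S ∈ 𝒮, ∀ S' ∈ 𝒮, S ≠ S' → Disjoint (interior S) (interior S'))
    (hcl : closure κ = ⋃ S ∈ 𝒮, S) (f : Euc d → ℝ≥0∞) :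
    ∑ S ∈ 𝒮, ∫⁻ x in S, f x ≤ ∫⁻ x in κ, f x := by
  have h1 : ∀ S ∈ 𝒮, ∫⁻ x in S, f x = ∫⁻ x in interior S, f x := fun S hSm =>
    setLIntegral_congr (interior_ae_eq_of_null_frontier
      ((hS S hSm).convex.addHaar_frontier volume)).symm
  rw [Finset.sum_congr rfl h1, ← lintegral_biUnion_finset (fun S hSm S' hSm' hne =>
    hdisj S hSm S' hSm' hne) fun S _ => isOpen_interior.measurableSet]
  refine lintegral_mono_set (Set.iUnion₂_subset fun S hSm => ?_)
  rw [← hκ, hcl]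
  exact interior_mono (Set.subset_biUnion_of_mem (u := fun S => S) hSm)

theorem setLIntegral_le_sum (hcl : closure κ = ⋃ S ∈ 𝒮, S) (f : Euc d → ℝ≥0∞) :
    ∫⁻ x in κ, f x ≤ ∑ S ∈ 𝒮, ∫⁻ x in S, f x :=
  (lintegral_mono_set (subset_closure.trans hcl.subset)).trans
    (setLIntegral_biUnion_finset_le _ _ _ _)

theorem frontier_subset_biUnion_frontier (hκ : interior (closure κ) = κ)
    (hS : ∀ S ∈ 𝒮, IsSimplex d S)
    (hcl : closure κ = ⋃ S ∈ 𝒮, S) : frontier κ ⊆ ⋃ S ∈ 𝒮, frontier S := by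
  intro x hx
  have hx1 : x ∈ ⋃ S ∈ 𝒮, S := hcl ▸ frontier_subset_closure hx
  obtain ⟨S, hSm, hxS⟩ := Set.mem_iUnion₂.1 hx1
  refine Set.mem_iUnion₂.2 ⟨S, hSm, ?_⟩
  rw [(hS S hSm).isCompact.isClosed.frontier_eq]
  refine ⟨hxS, fun hint => ?_⟩
  have hxi : x ∈ interior (closure κ) := by
    rw [hcl]
    exact interior_mono (Set.subset_biUnion_of_mem (u := fun S => S) hSm) hint
  have hxκ : x ∈ interior κ := by
    rw [← hκ, interior_interior]
    exact hxi
  exact hx.2 hxκ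

end

variable {n : ℕ} {κ : Set (Euc (n + 1))} {𝒮 : Finset (Set (Euc (n + 1)))}
variable {R : ℝ} {p : ℕ}

theorem element_lintegral_pderiv_sq_le (hκ : interior (closure κ) = κ)
    (hS : ∀ S ∈ 𝒮, IsSimplex (n + 1) S)
    (hdisj : ∀ S ∈ 𝒮, ∀ S' ∈ 𝒮, S ≠ S' → Disjoint (interior S) (interior S'))
    (hcl : closure κ = ⋃ S ∈ 𝒮, S) (hR : 0 < R)
    (hball : ∀ S ∈ 𝒮, ∃ z, Metric.closedBall z R ⊆ S) (hp : 1 ≤ p)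
    {P : MvPolynomial (Fin (n + 1)) ℝ} (hP : P.totalDegree ≤ p) (i : Fin (n + 1)) :
    ∫⁻ x in κ, ENNReal.ofReal (polyFun (MvPolynomial.pderiv i P) x ^ 2) ≤
      ENNReal.ofReal (4 * markovConst n * p ^ 4 / R ^ 2) *
        ∫⁻ x in κ, ENNReal.ofReal (polyFun P x ^ 2) := by
  refine (setLIntegral_le_sum hcl _).trans ?_
  refine le_trans ?_ (mul_le_mul_right (sum_setLIntegral_le hκ hS hdisj hcl _) _)
  rw [Finset.mul_sum]
  refine Finset.sum_le_sum fun S hSm => ?_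
  obtain ⟨z, hz⟩ := hball S hSm
  exact lintegral_pderiv_sq_le hp (hS S hSm).isCompact (hS S hSm).convex hR hz hP i

theorem element_lintegral_frontier_sq_le (hκ : interior (closure κ) = κ)
    (hS : ∀ S ∈ 𝒮, IsSimplex (n + 1) S)
    (hdisj : ∀ S ∈ 𝒮, ∀ S' ∈ 𝒮, S ≠ S' → Disjoint (interior S) (interior S'))
    (hcl : closure κ = ⋃ S ∈ 𝒮, S) (hR : 0 < R)
    (hball : ∀ S ∈ 𝒮, ∃ z, Metric.closedBall z R ⊆ S) (hp : 1 ≤ p)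
    {P : MvPolynomial (Fin (n + 1)) ℝ} (hP : P.totalDegree ≤ p) :
    ∫⁻ x in frontier κ, ENNReal.ofReal (polyFun P x ^ 2) ∂(surf (n + 1)) ≤
      ENNReal.ofReal ((n + 2) * traceConst n * p ^ 2 / R) *
        ∫⁻ x in κ, ENNReal.ofReal (polyFun P x ^ 2) := by
  refine (lintegral_mono_set (frontier_subset_biUnion_frontier hκ hS hcl)).trans ?_
  refine (setLIntegral_biUnion_finset_le _ _ _ _).trans ?_
  refine le_trans ?_ (mul_le_mul_right (sum_setLIntegral_le hκ hS hdisj hcl _) _)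
  rw [Finset.mul_sum]
  refine Finset.sum_le_sum fun S hSm => ?_
  obtain ⟨z, hz⟩ := hball S hSm
  exact (hS S hSm).lintegral_frontier_sq_le hp hR hz hP

end Subtriangulation

theorem integrableOn_of_continuous {d : ℕ} {μ : Measure (Euc d)} {s : Set (Euc d)}
    (hs : Bornology.IsBounded s) (hμ : μ s < ∞) {f : Euc d → ℝ}
    (hf : Continuous f) : IntegrableOn f s μ := by
  obtain ⟨C, hC⟩ := hs.isCompact_closure.exists_bound_of_continuousOn hf.continuousOn
  have hmem : ∀ᵐ x ∂(μ.restrict s), x ∈ closure s := by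
    have h1 : ∀ᵐ x ∂(μ.restrict (closure s)), x ∈ closure s :=
      ae_restrict_mem isClosed_closure.measurableSet
    exact ae_restrict_of_ae_restrict_of_subset subset_closure h1
  exact IntegrableOn.of_bound hμ hf.aestronglyMeasurable C
    (hmem.mono fun x hx => hC x hx)

theorem setLIntegral_ofReal_sq {d : ℕ} {μ : Measure (Euc d)} {s : Set (Euc d)}
    (hs : Bornology.IsBounded s) (hμ : μ s < ∞) {f : Euc d → ℝ} (hf : Continuous f) :
    ∫⁻ x in s, ENNReal.ofReal (f x ^ 2) ∂μ = ENNReal.ofReal (∫ x in s, f x ^ 2 ∂μ) :=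
  (ofReal_integral_eq_lintegral_ofReal (integrableOn_of_continuous hs hμ (hf.pow 2))
    (.of_forall fun _ => sq_nonneg _)).symm

section Mesh

variable {d : ℕ} {Ω : Set (Euc d)}

theorem IsConvexPolytopalDomain.isBounded (hΩ : IsConvexPolytopalDomain Ω) :
    Bornology.IsBounded Ω := by
  obtain ⟨s, hs⟩ := hΩ.closure_eq
  refine Bornology.IsBounded.subset ?_ subset_closure
  rw [hs]
  exact (s.finite_toSet.isCompact_convexHull (𝕜 := ℝ)).isBounded

variable {T : PolyMesh Ω}

theorem PolyMesh.isBounded_element (hΩ : IsConvexPolytopalDomain Ω) {κ : Set (Euc d)} (hκ : κ ∈ T.elements) :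
    Bornology.IsBounded κ :=
  hΩ.isBounded.subset (T.subset κ hκ)

theorem PolyMesh.diam_pos [NeZero d] (hΩ : IsConvexPolytopalDomain Ω) {κ : Set (Euc d)}
    (hκ : κ ∈ T.elements) :
    0 < Metric.diam κ := by
  have h := T.isPolytopal κ hκ
  obtain ⟨x, hx⟩ := h.nonempty
  obtain ⟨ε, hε, hb⟩ := Metric.isOpen_iff.1 h.isOpen x hx
  have := Metric.diam_mono hb (T.isBounded_element hΩ hκ)
  have : Nontrivial (Euc d) := inferInstance
  obtain ⟨w, hw⟩ := exists_norm_eq (Euc d) (half_pos hε).le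
  have h1 : x + w ∈ κ := hb (by simp [hw, hε])
  have h2 := Metric.dist_le_diam_of_mem (T.isBounded_element hΩ hκ) h1 hx
  rw [dist_self_add_left, hw] at h2
  linarith

theorem PolyMesh.diam_le_meshSize {κ : Set (Euc d)} (hκ : κ ∈ T.elements) :
    Metric.diam κ ≤ T.meshSize :=
  le_csSup ((T.elements.finite_toSet.image _).bddAbove) ⟨κ, hκ, rfl⟩

theorem PolyMesh.meshSize_pos [NeZero d] (hΩ : IsConvexPolytopalDomain Ω) : 0 < T.meshSize := by
  obtain ⟨x, hx⟩ := hΩ.nonempty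
  have h := T.closure_eq ▸ subset_closure hx
  obtain ⟨κ, hκ, -⟩ := Set.mem_iUnion₂.1 h
  exact (PolyMesh.diam_pos hΩ hκ).trans_le (T.diam_le_meshSize hκ)

end Mesh

/-- The inverse inequality and the trace inequality on the elements of a quasi-uniform mesh of mesh
size `h`, with constants that depend only on the mesh parameters. -/
theorem exists_element_estimates (n : ℕ) {c₂ γ c₃ Cq : ℝ} (hc₂ : 0 < c₂) (hγ : 0 < γ)
    (hc₃ : 0 < c₃) (hCq : 0 < Cq) :
    ∃ C : ℝ, 0 < C ∧ ∀ (Ω : Set (Euc (n + 1))), IsConvexPolytopalDomain Ω →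
      ∀ (T : PolyMesh Ω), T.ShapeRegular c₂ → T.ShapeRegularSubtriangulation γ c₃ →
        T.QuasiUniform Cq → ∀ κ ∈ T.elements, surf (n + 1) (frontier κ) < ∞ ∧
        ∀ p : ℕ, 1 ≤ p → ∀ P : MvPolynomial (Fin (n + 1)) ℝ, P.totalDegree ≤ p →
        (∀ i, ∫ x in κ, polyFun (MvPolynomial.pderiv i P) x ^ 2 ≤
          C * (p ^ 4 / T.meshSize ^ 2) * ∫ x in κ, polyFun P x ^ 2) ∧
        ∫ x in frontier κ, polyFun P x ^ 2 ∂(surf (n + 1)) ≤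
          C * (p ^ 2 / T.meshSize) * ∫ x in κ, polyFun P x ^ 2 := by
  set θ := min 1 (c₃ * c₂ / vol (Metric.ball (0 : Euc (n + 1)) 1)) with hθ
  have hθ0 : 0 < θ := lt_min one_pos (div_pos (mul_pos hc₃ hc₂)
    (ENNReal.toReal_pos (Metric.measure_ball_pos _ _ one_pos).ne' measure_ball_lt_top.ne))
  -- every simplex of the sub-triangulations contains a ball of radius `τ` times the mesh size
  set τ := θ / (γ * Cq) with hτ
  have hτ0 : 0 < τ := by positivity
  have hK := markovConst_pos n
  have hT := traceConst_pos n
  refine ⟨4 * markovConst n / τ ^ 2 + (n + 2) * traceConst n / τ, by positivity, ?_⟩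
  intro Ω hΩ T hreg hsub hqu κ hκ
  have hpoly := T.isPolytopal κ hκ
  have hbdd := T.isBounded_element hΩ hκ
  have hdiam := T.diam_pos hΩ hκ
  have hh := T.meshSize_pos hΩ
  obtain ⟨𝒮, h𝒮, hdisj, hcl⟩ := hsub κ hκ
  have hS : ∀ S ∈ 𝒮, IsSimplex (n + 1) S := fun S h => (h𝒮 S h).1
  set R := τ * T.meshSize with hRdef
  have hR : 0 < R := by positivity
  have hball : ∀ S ∈ 𝒮, ∃ z, Metric.closedBall z R ⊆ S := by
    intro S hSm
    obtain ⟨hSs, ⟨z, r, hzr, hγr⟩, hvol⟩ := h𝒮 S hSm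
    refine ⟨z, (Metric.closedBall_subset_closedBall ?_).trans hzr⟩
    have hv : c₃ * c₂ * Metric.diam κ ^ (n + 1) ≤ vol S :=
      le_trans (by rw [mul_assoc]; gcongr; exact (hreg κ hκ).2) hvol
    have hvpos : 0 < vol S := lt_of_lt_of_le (by positivity) hv
    have hne : S.Nonempty := by
      rw [Set.nonempty_iff_ne_empty]
      rintro rfl
      simp [vol] at hvpos
    have h1 := mul_le_of_vol_ge n.succ_ne_zero hSs.isCompact.isBounded hne hdiam.le hγr
      (mul_pos hc₃ hc₂) hv
    rw [hRdef, hτ, div_mul_eq_mul_div, div_le_iff₀ (by positivity)]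
    calc θ * T.meshSize ≤ θ * (Cq * Metric.diam κ) := by
          gcongr
          exact hqu κ hκ
      _ = Cq * (θ * Metric.diam κ) := by ring
      _ ≤ Cq * (γ * r) := by gcongr
      _ = r * (γ * Cq) := by ring
  have hκfin : (volume : Measure (Euc (n + 1))) κ < ∞ := hbdd.measure_lt_top
  have hfr : Bornology.IsBounded (frontier κ) :=
    hbdd.closure.subset frontier_subset_closure
  have hsurf : surf (n + 1) (frontier κ) < ∞ := by
    -- the trace inequality for the constant polynomial `1`
    have h := element_lintegral_frontier_sq_le hpoly.interior_closure hS hdisj hcl hR hball le_rfl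
      (P := 1) (by simp)
    simp only [polyFun, map_one, one_pow, ENNReal.ofReal_one, lintegral_one,
      Measure.restrict_apply_univ] at h
    exact h.trans_lt (ENNReal.mul_lt_top ENNReal.ofReal_lt_top hκfin)
  refine ⟨hsurf, fun p hp P hP => ⟨fun i => ?_, ?_⟩⟩
  · have h := element_lintegral_pderiv_sq_le hpoly.interior_closure hS hdisj hcl hR hball hp hP i
    have h0 : 0 ≤ ∫ x in κ, polyFun P x ^ 2 := integral_nonneg fun _ => sq_nonneg _
    rw [setLIntegral_ofReal_sq hbdd hκfin (continuous_polyFun _),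
      setLIntegral_ofReal_sq hbdd hκfin (continuous_polyFun _),
      ← ENNReal.ofReal_mul (by positivity), ENNReal.ofReal_le_ofReal_iff (by positivity)] at h
    refine h.trans (mul_le_mul_of_nonneg_right ?_ h0)
    have e : 4 * markovConst n * p ^ 4 / R ^ 2 =
        4 * markovConst n / τ ^ 2 * (p ^ 4 / T.meshSize ^ 2) := by
      rw [hRdef]; field_simp
    rw [e]
    gcongr
    exact le_add_of_nonneg_right (by positivity)
  · have h := element_lintegral_frontier_sq_le hpoly.interior_closure hS hdisj hcl hR hball hp hP
    have h0 : 0 ≤ ∫ x in κ, polyFun P x ^ 2 := integral_nonneg fun _ => sq_nonneg _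
    rw [setLIntegral_ofReal_sq hfr hsurf (continuous_polyFun _),
      setLIntegral_ofReal_sq hbdd hκfin (continuous_polyFun _),
      ← ENNReal.ofReal_mul (by positivity), ENNReal.ofReal_le_ofReal_iff (by positivity)] at h
    refine h.trans (mul_le_mul_of_nonneg_right ?_ h0)
    have e : (n + 2) * traceConst n * p ^ 2 / R =
        (n + 2) * traceConst n / τ * (p ^ 2 / T.meshSize) := by
      rw [hRdef]; field_simp
    rw [e]
    gcongr
    exact le_add_of_nonneg_left (by positivity)

/-! ### Measurability of the outward normal -/

open scoped Classical

section Normal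

variable {d : ℕ} {κ : Set (Euc d)}

theorem IsOutwardNormal.unique {x n m : Euc d} (hn : IsOutwardNormal κ x n)
    (hm : IsOutwardNormal κ x m) : n = m := by
  by_contra hne
  have hlt : inner ℝ m n < 1 := by
    refine lt_of_le_of_ne ((real_inner_le_norm m n).trans (by rw [hn.1, hm.1, mul_one])) fun h => ?_
    exact hne ((inner_eq_one_iff_of_norm_eq_one hm.1 hn.1).1 h).symm
  -- the direction `m - n` points into the half-space of `n` and out of that of `m`
  have ht : Filter.Tendsto (fun t : ℝ => x + t • (m - n)) (nhdsWithin 0 (Set.Ioi 0)) (nhds x) := by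
    have : Continuous fun t : ℝ => x + t • (m - n) := by fun_prop
    simpa using (this.tendsto 0).mono_left nhdsWithin_le_nhds
  obtain ⟨t, ⟨h1, h2⟩, ht0⟩ := ((ht.eventually (hn.2.and hm.2)).and
    self_mem_nhdsWithin).exists
  have ht0 : 0 < t := ht0
  have h3 := h1.symm.trans h2
  rw [add_sub_cancel_left, inner_smul_left, inner_smul_left, inner_sub_left, inner_sub_left,
    real_inner_self_eq_norm_sq, real_inner_self_eq_norm_sq, hn.1, hm.1, real_inner_comm] at h3
  have h4 : inner ℝ n m < (1 : ℝ) := by rwa [real_inner_comm]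
  have h5 := h3.1 (mul_neg_of_pos_of_neg ht0 (by linarith))
  have h6 : 0 ≤ t * (1 ^ 2 - inner ℝ n m) := mul_nonneg ht0.le (by linarith)
  exact absurd h5 (not_lt.2 h6)

theorem IsOutwardNormal.eventually {x n : Euc d} (hn : IsOutwardNormal κ x n) :
    ∀ᶠ y in nhds x, y ∈ frontier κ → IsOutwardNormal κ y n := by
  filter_upwards [hn.2.eventually_nhds] with y hy hyf
  have hcont : Continuous fun w : Euc d => (inner ℝ (w - x) n : ℝ) := by fun_prop
  have h0 : inner ℝ (y - x) n = (0 : ℝ) := by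
    rcases lt_trichotomy (inner ℝ (y - x) n : ℝ) 0 with h | h | h
    · refine absurd (mem_interior_iff_mem_nhds.2 ?_) hyf.2
      filter_upwards [hy, hcont.continuousAt.eventually (gt_mem_nhds h)] with w hw hw' using hw.2 hw'
    · exact h
    · refine absurd hyf.1 fun hcl => ?_
      obtain ⟨w, hw, hwκ⟩ := (mem_closure_iff_nhds.1 hcl) _
        (Filter.inter_mem hy (hcont.continuousAt.eventually (lt_mem_nhds h)))
      exact absurd (hw.1.1 hwκ) (not_lt.2 (le_of_lt hw.2))
  refine ⟨hn.1, ?_⟩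
  filter_upwards [hy] with w hw
  rw [hw, ← sub_add_sub_cancel w y x, inner_add_left, h0, add_zero]

theorem IsOutwardNormal.outwardNormal_eq {x n : Euc d} (hn : IsOutwardNormal κ x n) :
    outwardNormal κ x = n := by
  have h : ∃ n, IsOutwardNormal κ x n := ⟨n, hn⟩
  rw [outwardNormal, dif_pos h]
  exact h.choose_spec.unique hn

theorem norm_outwardNormal_le (κ : Set (Euc d)) (x : Euc d) : ‖outwardNormal κ x‖ ≤ 1 := by
  by_cases h : ∃ n, IsOutwardNormal κ x n
  · obtain ⟨n, hn⟩ := h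
    rw [hn.outwardNormal_eq, hn.1]
  · rw [outwardNormal, dif_neg h]
    simp

/-- The outward normal is locally constant on a relatively open subset of the boundary and zero
on the rest of the boundary. -/
theorem aestronglyMeasurable_outwardNormal (μ : Measure (Euc d)) (κ : Set (Euc d)) :
    AEStronglyMeasurable (outwardNormal κ) (μ.restrict (frontier κ)) := by
  set U : Set (Euc d) := interior {y | y ∈ frontier κ → ∃ n, IsOutwardNormal κ y n}
  have hU : ∀ x n, IsOutwardNormal κ x n → x ∈ U := fun x n hn =>
    mem_interior_iff_mem_nhds.2 (hn.eventually.mono fun y hy hyf => ⟨n, hy hyf⟩)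
  have h1 : AEStronglyMeasurable (outwardNormal κ) (μ.restrict (frontier κ ∩ U)) := by
    refine ContinuousOn.aestronglyMeasurable (fun x hx => ?_)
      (isClosed_frontier.measurableSet.inter isOpen_interior.measurableSet)
    obtain ⟨n, hn⟩ := interior_subset hx.2 hx.1
    refine (continuousWithinAt_const (b := n)).congr_of_eventuallyEq ?_ hn.outwardNormal_eq
    filter_upwards [nhdsWithin_le_nhds hn.eventually, self_mem_nhdsWithin] with y hy hyf
    exact (hy hyf.1).outwardNormal_eq
  have h2 : AEStronglyMeasurable (outwardNormal κ) (μ.restrict (frontier κ \ U)) := by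
    refine (aestronglyMeasurable_const (b := (0 : Euc d))).congr ?_
    filter_upwards [ae_restrict_mem
      (s := frontier κ \ U)
      (isClosed_frontier.measurableSet.diff isOpen_interior.measurableSet)] with x hx
    rw [outwardNormal, dif_neg]
    rintro ⟨n, hn⟩
    exact hx.2 (hU x n hn)
  rw [← Set.inter_union_sdiff (frontier κ) U, aestronglyMeasurable_union_iff]
  exact ⟨h1, h2⟩

end Normal

/-! ### Local polynomials of discontinuous Galerkin functions -/

theorem eq_of_polyFun_ae_eq {d : ℕ} {κ : Set (Euc d)} (hκ : IsOpen κ) (hne : κ.Nonempty)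
    {P Q : MvPolynomial (Fin d) ℝ}
    (h : polyFun P =ᵐ[(volume : Measure (Euc d)).restrict κ] polyFun Q) : P = Q := by
  have heq := Measure.eqOn_open_of_ae_eq h hκ (continuous_polyFun P).continuousOn
    (continuous_polyFun Q).continuousOn
  -- a nonempty open set contains a box, and a polynomial is determined by its values on a box
  obtain ⟨x, hx⟩ := hne
  have ho : IsOpen ((WithLp.toLp 2 : (Fin d → ℝ) → Euc d) ⁻¹' κ) :=
    hκ.preimage (PiLp.continuous_toLp 2 _)
  obtain ⟨ε, hε, hb⟩ := Metric.isOpen_iff.1 ho (WithLp.ofLp x) hx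
  refine MvPolynomial.funext_set (fun i => Metric.ball (x i) ε) (fun i => ?_) fun y hy => ?_
  · rw [Real.ball_eq_Ioo]
    exact Set.Ioo_infinite (by linarith)
  · rw [← ball_pi _ hε] at hy
    exact heq (hb hy)

section Rep

variable {d : ℕ} {Ω : Set (Euc d)} {T : PolyMesh Ω} {p : ℕ}

/-- The polynomial whose function is `localPoly u κ`. -/
noncomputable def localRep (u : dgSpace T p) (κ : Set (Euc d)) : MvPolynomial (Fin d) ℝ :=
  if h : κ ∈ T.elements then (u.2 κ h).choose else 0

theorem localPoly_eq (u : dgSpace T p) (κ : Set (Euc d)) :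
    localPoly u κ = polyFun (localRep u κ) := by
  by_cases h : κ ∈ T.elements
  · rw [localPoly, localRep, dif_pos h, dif_pos h]
  · rw [localPoly, localRep, dif_neg h, dif_neg h]
    ext x
    simp [polyFun]

theorem totalDegree_localRep_le (u : dgSpace T p) (κ : Set (Euc d)) :
    (localRep u κ).totalDegree ≤ p := by
  by_cases h : κ ∈ T.elements
  · rw [localRep, dif_pos h]
    exact (u.2 κ h).choose_spec.1
  · rw [localRep, dif_neg h]
    simp

theorem ae_eq_localRep (u : dgSpace T p) {κ : Set (Euc d)} (h : κ ∈ T.elements) :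
    (u : Lp ℝ 2 ((volume : Measure (Euc d)).restrict Ω)) =ᵐ[volume.restrict κ]
      polyFun (localRep u κ) := by
  rw [localRep, dif_pos h]
  exact (u.2 κ h).choose_spec.2

theorem localRep_add (u v : dgSpace T p) (κ : Set (Euc d)) :
    localRep (u + v) κ = localRep u κ + localRep v κ := by
  by_cases h : κ ∈ T.elements
  · refine eq_of_polyFun_ae_eq (T.isPolytopal κ h).isOpen (T.isPolytopal κ h).nonempty ?_
    have h' := ae_restrict_of_ae_restrict_of_subset (T.subset κ h)
      (Lp.coeFn_add (u : Lp ℝ 2 ((volume : Measure (Euc d)).restrict Ω)) v)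
    filter_upwards [ae_eq_localRep (u + v) h, ae_eq_localRep u h, ae_eq_localRep v h, h']
      with x h1 h2 h3 h4
    rw [← h1, Submodule.coe_add, h4, Pi.add_apply, h2, h3]
    simp [polyFun]
  · simp [localRep, h]

theorem localRep_smul (c : ℝ) (u : dgSpace T p) (κ : Set (Euc d)) :
    localRep (c • u) κ = c • localRep u κ := by
  by_cases h : κ ∈ T.elements
  · refine eq_of_polyFun_ae_eq (T.isPolytopal κ h).isOpen (T.isPolytopal κ h).nonempty ?_
    have h' := ae_restrict_of_ae_restrict_of_subset (T.subset κ h)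
      (Lp.coeFn_smul c (u : Lp ℝ 2 ((volume : Measure (Euc d)).restrict Ω)))
    filter_upwards [ae_eq_localRep (c • u) h, ae_eq_localRep u h, h'] with x h1 h2 h4
    rw [← h1, Submodule.coe_smul, h4, Pi.smul_apply, h2]
    simp [polyFun]
  · simp [localRep, h]

theorem localPoly_add (u v : dgSpace T p) (κ : Set (Euc d)) (x : Euc d) :
    localPoly (u + v) κ x = localPoly u κ x + localPoly v κ x := by
  simp [localPoly_eq, localRep_add, polyFun]

theorem localPoly_smul (c : ℝ) (u : dgSpace T p) (κ : Set (Euc d)) (x : Euc d) :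
    localPoly (c • u) κ x = c * localPoly u κ x := by
  simp [localPoly_eq, localRep_smul, polyFun]

theorem gradient_localPoly_add (u v : dgSpace T p) (κ : Set (Euc d)) (x : Euc d) :
    gradient (localPoly (u + v) κ) x = gradient (localPoly u κ) x + gradient (localPoly v κ) x := by
  ext i
  simp [localPoly_eq, localRep_add, gradient_polyFun, polyFun]

theorem gradient_localPoly_smul (c : ℝ) (u : dgSpace T p) (κ : Set (Euc d)) (x : Euc d) :
    gradient (localPoly (c • u) κ) x = c • gradient (localPoly u κ) x := by
  ext i
  simp [localPoly_eq, localRep_smul, gradient_polyFun, polyFun]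

theorem continuous_localPoly (u : dgSpace T p) (κ : Set (Euc d)) : Continuous (localPoly u κ) := by
  rw [localPoly_eq]
  exact continuous_polyFun _

theorem continuous_gradient_localPoly (u : dgSpace T p) (κ : Set (Euc d)) :
    Continuous (gradient (localPoly u κ)) := by
  have : gradient (localPoly u κ) = fun x =>
      WithLp.toLp 2 fun i => polyFun (MvPolynomial.pderiv i (localRep u κ)) x := by
    ext1 x
    rw [localPoly_eq, gradient_polyFun]
  rw [this]
  exact (PiLp.continuous_toLp 2 _).comp (continuous_pi fun i => continuous_polyFun _)

theorem norm_sq_gradient_localPoly (u : dgSpace T p) (κ : Set (Euc d)) (x : Euc d) :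
    ‖gradient (localPoly u κ) x‖ ^ 2 =
      ∑ i, polyFun (MvPolynomial.pderiv i (localRep u κ)) x ^ 2 := by
  rw [localPoly_eq, gradient_polyFun, EuclideanSpace.norm_sq_eq]
  simp

theorem measurableSet_element {κ : Set (Euc d)} (h : κ ∈ T.elements) : MeasurableSet κ :=
  (T.isPolytopal κ h).isOpen.measurableSet

theorem sum_integral_localPoly_sq_le (u : dgSpace T p) :
    ∑ κ ∈ T.elements, ∫ x in κ, localPoly u κ x ^ 2 ≤ ‖u‖ ^ 2 := by
  set f : Lp ℝ 2 ((volume : Measure (Euc d)).restrict Ω) := u.1 with hf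
  have hint : Integrable (fun x => f x ^ 2) ((volume : Measure (Euc d)).restrict Ω) :=
    (Lp.memLp f).integrable_sq
  have hnorm : ‖u‖ ^ 2 = ∫ x in Ω, f x ^ 2 := by
    rw [Submodule.coe_norm, ← real_inner_self_eq_norm_sq, L2.inner_def]
    refine integral_congr_ae (.of_forall fun x => ?_)
    simp [hf, sq]
  have h1 : ∀ κ ∈ T.elements, ∫ x in κ, localPoly u κ x ^ 2 = ∫ x in κ, f x ^ 2 := by
    intro κ h
    refine integral_congr_ae ?_
    filter_upwards [ae_eq_localRep u h] with x hx
    rw [localPoly_eq, ← hx]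
  have hsub : ⋃ κ ∈ T.elements, κ ⊆ Ω := Set.iUnion₂_subset fun κ h => T.subset κ h
  rw [Finset.sum_congr rfl h1, hnorm, ← integral_biUnion_finset T.elements
    (s := fun κ => κ) (fun κ h => measurableSet_element h) T.disjoint
    (fun κ h => IntegrableOn.mono_set hint (T.subset κ h))]
  exact setIntegral_mono_set hint (.of_forall fun x => sq_nonneg _) hsub.eventuallyLE

/-- A function in the discontinuous Galerkin space is determined by its local polynomials, since the
elements cover `Ω` up to a null set. -/
theorem dgSpace_finiteDimensional :
    FiniteDimensional ℝ (dgSpace T p) := by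
  let φ : dgSpace T p →ₗ[ℝ] (T.elements → MvPolynomial.restrictTotalDegree (Fin d) ℝ p) :=
    { toFun := fun u κ => ⟨localRep u κ,
        (MvPolynomial.mem_restrictTotalDegree _ _ _).2 (totalDegree_localRep_le u κ)⟩
      map_add' := fun u v => by
        ext1 κ
        exact Subtype.ext (localRep_add u v κ)
      map_smul' := fun c u => by
        ext1 κ
        exact Subtype.ext (localRep_smul c u κ) }
  refine FiniteDimensional.of_injective φ ((injective_iff_map_eq_zero φ).2 fun u hu => ?_)
  have hrep : ∀ κ ∈ T.elements, localRep u κ = 0 := fun κ h =>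
    congrArg Subtype.val (congrFun hu ⟨κ, h⟩)
  have hnull : (volume : Measure (Euc d)) (Ω \ ⋃ κ ∈ T.elements, κ) = 0 := by
    have hsub : Ω \ ⋃ κ ∈ T.elements, κ ⊆ ⋃ κ ∈ T.elements, frontier κ := by
      rintro x ⟨hx, hx'⟩
      have h1 := T.closure_eq ▸ subset_closure hx
      obtain ⟨κ, h, hxκ⟩ := Set.mem_iUnion₂.1 h1
      refine Set.mem_iUnion₂.2 ⟨κ, h, ?_⟩
      rw [(T.isPolytopal κ h).isOpen.frontier_eq]
      exact ⟨hxκ, fun hk => hx' (Set.mem_iUnion₂.2 ⟨κ, h, hk⟩)⟩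
    refine measure_mono_null hsub ((measure_biUnion_null_iff T.elements.countable_toSet).2
      fun κ h => ?_)
    have hp := T.isPolytopal κ h
    obtain ⟨𝒮, hS, hcl⟩ := hp.closure_eq
    refine measure_mono_null
      (frontier_subset_biUnion_frontier hp.interior_closure hS hcl)
      ((measure_biUnion_null_iff 𝒮.countable_toSet).2 fun S hSm => ?_)
    exact (hS S hSm).convex.addHaar_frontier volume
  have h0 : (u : Lp ℝ 2 ((volume : Measure (Euc d)).restrict Ω)) =ᵐ[volume.restrict Ω] 0 := by
    have hΩ' : Ω ⊆ (⋃ κ ∈ T.elements, κ) ∪ (Ω \ ⋃ κ ∈ T.elements, κ) := by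
      rw [Set.union_sdiff_self]; exact Set.subset_union_right
    refine ae_restrict_of_ae_restrict_of_subset hΩ' ?_
    rw [ae_restrict_union_iff]
    refine ⟨?_, by rw [Measure.restrict_eq_zero.2 hnull]; simp⟩
    rw [ae_restrict_biUnion_finset_iff]
    intro κ h
    filter_upwards [ae_eq_localRep u h] with x hx
    rw [hx, hrep κ h]
    simp [polyFun]
  exact Subtype.ext (Lp.eq_zero_iff_ae_eq_zero.2 h0)

end Rep

/-! ### Bounds for the bilinear form -/

theorem sum_setIntegral_le_of_aedisjoint {X : Type*} [MeasurableSpace X] {μ : Measure X}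
    {s : Finset (Set X)} {A : Set X} (hm : ∀ F ∈ s, MeasurableSet F) (hA : ∀ F ∈ s, F ⊆ A)
    (hd : ∀ F ∈ s, ∀ F' ∈ s, F ≠ F' → μ (F ∩ F') = 0) {f : X → ℝ} (hf : IntegrableOn f A μ)
    (h0 : ∀ x, 0 ≤ f x) : ∑ F ∈ s, ∫ x in F, f x ∂μ ≤ ∫ x in A, f x ∂μ := by
  have hpos : ∀ B : Set X, 0 ≤ ∫ x in B, f x ∂μ := fun B => integral_nonneg h0
  rw [← ENNReal.ofReal_le_ofReal_iff (hpos A), ENNReal.ofReal_sum_of_nonneg fun F _ => hpos F,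
    ofReal_integral_eq_lintegral_ofReal hf (.of_forall h0)]
  have h1 : ∀ F ∈ s, ENNReal.ofReal (∫ x in F, f x ∂μ) = ∫⁻ x in F, ENNReal.ofReal (f x) ∂μ :=
    fun F hF => ofReal_integral_eq_lintegral_ofReal (hf.mono_set (hA F hF)) (.of_forall h0)
  rw [Finset.sum_congr rfl h1, ← lintegral_biUnion_finset₀ (t := fun F => F)
    (fun F hF F' hF' hne => hd F hF F' hF' hne) fun F hF => (hm F hF).nullMeasurableSet]
  exact lintegral_mono_set (Set.iUnion₂_subset hA)

section Face

variable {d : ℕ} {Ω : Set (Euc d)} {T : PolyMesh Ω} {p : ℕ} {F : Set (Euc d)}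

theorem PolyMesh.mem_neighbors {κ : Set (Euc d)} :
    κ ∈ T.neighbors F ↔ κ ∈ T.elements ∧ F ⊆ frontier κ := by
  simp [PolyMesh.neighbors]

theorem PolyMesh.neighbors_nonempty (hF : F ∈ T.faces) : (T.neighbors F).Nonempty := by
  rcases T.interior_or_boundary F hF with ⟨κ₁, κ₂, -, h⟩ | ⟨-, κ₁, h⟩
  · exact ⟨κ₁, by rw [PolyMesh.neighbors, h]; simp⟩
  · exact ⟨κ₁, by rw [PolyMesh.neighbors, h]; simp⟩

theorem PolyMesh.card_neighbors_le (hF : F ∈ T.faces) : (T.neighbors F).card ≤ 2 := by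
  rcases T.interior_or_boundary F hF with ⟨κ₁, κ₂, -, h⟩ | ⟨-, κ₁, h⟩
  · rw [PolyMesh.neighbors, h]
    exact Finset.card_le_two
  · rw [PolyMesh.neighbors, h]
    simp

theorem PolyMesh.measurableSet_face (hF : F ∈ T.faces) : MeasurableSet F :=
  (T.isSimplex_face F hF).isCompact.isClosed.measurableSet

theorem norm_avgGrad_sq_le (u : dgSpace T p) (hF : F ∈ T.faces) (x : Euc d) :
    ‖avgGrad u F x‖ ^ 2 ≤ ∑ κ ∈ T.neighbors F, ‖gradient (localPoly u κ) x‖ ^ 2 := by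
  have hc : (1 : ℝ) ≤ (T.neighbors F).card := by
    exact_mod_cast Finset.card_pos.2 (T.neighbors_nonempty hF)
  have h1 : ‖∑ κ ∈ T.neighbors F, gradient (localPoly u κ) x‖ ^ 2 ≤
      (T.neighbors F).card * ∑ κ ∈ T.neighbors F, ‖gradient (localPoly u κ) x‖ ^ 2 :=
    (pow_le_pow_left₀ (norm_nonneg _) (norm_sum_le _ _) 2).trans sq_sum_le_card_mul_sum_sq
  have h2 : 0 ≤ ∑ κ ∈ T.neighbors F, ‖gradient (localPoly u κ) x‖ ^ 2 :=
    Finset.sum_nonneg fun _ _ => sq_nonneg _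
  rw [avgGrad, norm_smul, mul_pow, norm_inv, Real.norm_natCast]
  calc _ ≤ ((T.neighbors F).card : ℝ)⁻¹ ^ 2 * ((T.neighbors F).card *
        ∑ κ ∈ T.neighbors F, ‖gradient (localPoly u κ) x‖ ^ 2) := by gcongr
    _ = ((T.neighbors F).card : ℝ)⁻¹ *
        ∑ κ ∈ T.neighbors F, ‖gradient (localPoly u κ) x‖ ^ 2 := by
      field_simp
    _ ≤ _ := mul_le_of_le_one_left h2 (inv_le_one_of_one_le₀ hc)

theorem norm_jump_le (u : dgSpace T p) (F : Set (Euc d)) (x : Euc d) :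
    ‖jump u F x‖ ≤ ∑ κ ∈ T.neighbors F, |localPoly u κ x| := by
  refine (norm_sum_le _ _).trans (Finset.sum_le_sum fun κ _ => ?_)
  rw [norm_smul, Real.norm_eq_abs]
  exact mul_le_of_le_one_right (abs_nonneg _) (norm_outwardNormal_le κ x)

theorem norm_jump_sq_le (u : dgSpace T p) (hF : F ∈ T.faces) (x : Euc d) :
    ‖jump u F x‖ ^ 2 ≤ 2 * ∑ κ ∈ T.neighbors F, localPoly u κ x ^ 2 := by
  have hc : ((T.neighbors F).card : ℝ) ≤ 2 := by exact_mod_cast T.card_neighbors_le hF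
  calc _ ≤ (∑ κ ∈ T.neighbors F, |localPoly u κ x|) ^ 2 :=
        pow_le_pow_left₀ (norm_nonneg _) (norm_jump_le u F x) 2
    _ ≤ (T.neighbors F).card * ∑ κ ∈ T.neighbors F, |localPoly u κ x| ^ 2 :=
        sq_sum_le_card_mul_sum_sq
    _ ≤ _ := by
      simp only [sq_abs]
      gcongr

theorem penalty_nonneg {Cσ : ℝ} (hCσ : 0 ≤ Cσ) (F : Set (Euc d)) : 0 ≤ penalty T p Cσ F := by
  refine mul_nonneg hCσ (Real.sSup_nonneg ?_)
  rintro _ ⟨κ, -, rfl⟩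
  exact div_nonneg (by positivity) Metric.diam_nonneg

theorem penalty_le [NeZero d] (hΩ : IsConvexPolytopalDomain Ω) {Cσ Cq : ℝ} (hCσ : 0 ≤ Cσ)
    (hq : T.QuasiUniform Cq) (hF : F ∈ T.faces) :
    penalty T p Cσ F ≤ Cσ * Cq * (p ^ 2 / T.meshSize) := by
  rw [penalty, mul_assoc]
  refine mul_le_mul_of_nonneg_left (csSup_le ?_ ?_) hCσ
  · exact Set.Nonempty.image _ (T.neighbors_nonempty hF)
  · rintro _ ⟨κ, hκ, rfl⟩
    have hκ' := (PolyMesh.mem_neighbors.1 hκ).1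
    have h1 := T.diam_pos hΩ hκ'
    have h2 := T.meshSize_pos hΩ
    simp only
    rw [← mul_div_assoc, div_le_div_iff₀ h1 h2]
    have := mul_le_mul_of_nonneg_left (hq κ hκ') (sq_nonneg (p : ℝ))
    linarith

theorem PolyMesh.isBounded_face (hF : F ∈ T.faces) : Bornology.IsBounded F :=
  (T.isSimplex_face F hF).isCompact.isBounded

theorem PolyMesh.surf_face_lt_top (hsurf : ∀ κ ∈ T.elements, surf d (frontier κ) < ∞)
    (hF : F ∈ T.faces) : surf d F < ∞ := by
  obtain ⟨κ, hκ⟩ := T.neighbors_nonempty hF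
  rw [PolyMesh.mem_neighbors] at hκ
  exact (measure_mono hκ.2).trans_lt (hsurf κ hκ.1)

/-- A sum over the faces of contributions of their neighbours is bounded by a sum over the element
boundaries, since the faces on an element boundary do not overlap. -/
theorem sum_faces_le (hΩ : IsConvexPolytopalDomain Ω)
    (hsurf : ∀ κ ∈ T.elements, surf d (frontier κ) < ∞) {b : Set (Euc d) → Euc d → ℝ}
    (hb : ∀ κ, Continuous (b κ)) (h0 : ∀ κ x, 0 ≤ b κ x) :
    ∑ F ∈ T.faces, ∫ x in F, ∑ κ ∈ T.neighbors F, b κ x ∂(surf d) ≤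
      ∑ κ ∈ T.elements, ∫ x in frontier κ, b κ x ∂(surf d) := by
  have h1 : ∀ F ∈ T.faces, ∫ x in F, ∑ κ ∈ T.neighbors F, b κ x ∂(surf d) =
      ∑ κ ∈ T.neighbors F, ∫ x in F, b κ x ∂(surf d) := fun F hF =>
    integral_finsetSum _ fun κ _ =>
      integrableOn_of_continuous (T.isBounded_face hF) (T.surf_face_lt_top hsurf hF) (hb κ)
  rw [Finset.sum_congr rfl h1, Finset.sum_comm' (t' := T.elements)
    (s' := fun κ => T.faces.filter fun F => F ⊆ frontier κ) (by
      intro F κ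
      simp only [PolyMesh.mem_neighbors, Finset.mem_filter]
      tauto)]
  refine Finset.sum_le_sum fun κ hκ => ?_
  refine sum_setIntegral_le_of_aedisjoint (fun F hF => ?_) (fun F hF => ?_)
    (fun F hF F' hF' hne => ?_) ?_ (h0 κ)
  · exact T.measurableSet_face (Finset.mem_filter.1 hF).1
  · exact (Finset.mem_filter.1 hF).2
  · exact T.face_overlap F (Finset.mem_filter.1 hF).1 F' (Finset.mem_filter.1 hF').1 hne
  · exact integrableOn_of_continuous
      ((T.isBounded_element hΩ hκ).closure.subset frontier_subset_closure) (hsurf κ hκ) (hb κ)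

theorem setIntegral_norm_sq_gradient_localPoly (u : dgSpace T p) (κ : Set (Euc d))
    {μ : Measure (Euc d)} {s : Set (Euc d)} (hs : Bornology.IsBounded s) (hμ : μ s < ∞) :
    ∫ x in s, ‖gradient (localPoly u κ) x‖ ^ 2 ∂μ =
      ∑ i, ∫ x in s, polyFun (MvPolynomial.pderiv i (localRep u κ)) x ^ 2 ∂μ := by
  simp only [norm_sq_gradient_localPoly]
  exact integral_finsetSum _ fun i _ =>
    integrableOn_of_continuous hs hμ ((continuous_polyFun _).pow 2 :)

/-- Young's inequality with a weight. -/
theorem two_mul_le_div_add_div {h q : ℝ} (hh : 0 < h) (hq : 0 < q) (A J : ℝ) :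
    2 * (A * J) ≤ h / q * A ^ 2 + q / h * J ^ 2 := by
  have e : h / q * A ^ 2 + q / h * J ^ 2 - 2 * (A * J) = (h * A - q * J) ^ 2 / (q * h) := by
    field_simp
    ring
  have : 0 ≤ (h * A - q * J) ^ 2 / (q * h) := by positivity
  linarith

/-- The contribution of a face to the quadratic form, bounded by the traces of the function and its
gradient from the neighbours of the face. -/
theorem abs_face_term_le [NeZero d] (hΩ : IsConvexPolytopalDomain Ω) {Cσ Cq : ℝ} (hCσ : 0 < Cσ)
    (hCq : 0 < Cq) (hqu : T.QuasiUniform Cq)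
    (hsurf : ∀ κ ∈ T.elements, surf d (frontier κ) < ∞) (hp : 1 ≤ p) (u : dgSpace T p)
    (hF : F ∈ T.faces) :
    |-(∫ x in F, (inner ℝ (avgGrad u F x) (jump u F x) + inner ℝ (jump u F x) (avgGrad u F x))
        ∂(surf d)) +
      ∫ x in F, penalty T p Cσ F * inner ℝ (jump u F x) (jump u F x) ∂(surf d)| ≤
      ∫ x in F, ∑ κ ∈ T.neighbors F,
        (T.meshSize / p ^ 2 * ‖gradient (localPoly u κ) x‖ ^ 2 +
          (2 + 2 * (Cσ * Cq)) * (p ^ 2 / T.meshSize) * localPoly u κ x ^ 2) ∂(surf d) := by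
  have hh := T.meshSize_pos hΩ
  set h := T.meshSize with hhdef
  have hp0 : (0 : ℝ) < p := by exact_mod_cast hp
  have hpen := penalty_le (p := p) hΩ hCσ.le hqu hF
  have hpen0 := penalty_nonneg (T := T) (p := p) hCσ.le F
  have hint : ∀ {f : Euc d → ℝ}, Continuous f → IntegrableOn f F (surf d) :=
    fun hf => integrableOn_of_continuous (T.isBounded_face hF) (T.surf_face_lt_top hsurf hF) hf
  set b₁ : Euc d → ℝ := fun x => ∑ κ ∈ T.neighbors F,
    (h / p ^ 2 * ‖gradient (localPoly u κ) x‖ ^ 2 + 2 * (p ^ 2 / h) * localPoly u κ x ^ 2)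
  set b₂ : Euc d → ℝ := fun x => ∑ κ ∈ T.neighbors F,
    2 * (Cσ * Cq) * (p ^ 2 / h) * localPoly u κ x ^ 2
  have hb₁c : Continuous b₁ := continuous_finsetSum _ fun κ _ => by
    have h1 := continuous_gradient_localPoly u κ
    have h2 := continuous_localPoly u κ
    fun_prop
  have hb₂c : Continuous b₂ := continuous_finsetSum _ fun κ _ => by
    have h2 := continuous_localPoly u κ
    fun_prop
  have h1 := norm_integral_le_of_norm_le (hint hb₁c)
    (f := fun x => inner ℝ (avgGrad u F x) (jump u F x) + inner ℝ (jump u F x) (avgGrad u F x))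
    (.of_forall fun x => by
      have ha := norm_avgGrad_sq_le u hF x
      have hj := norm_jump_sq_le u hF x
      have hi := abs_real_inner_le_norm (avgGrad u F x) (jump u F x)
      rw [real_inner_comm (avgGrad u F x), ← two_mul, Real.norm_eq_abs, abs_mul, abs_two]
      set A := ‖avgGrad u F x‖
      set J := ‖jump u F x‖
      have hy := two_mul_le_div_add_div hh (pow_pos hp0 2) A J
      have e : b₁ x = h / p ^ 2 * ∑ κ ∈ T.neighbors F, ‖gradient (localPoly u κ) x‖ ^ 2 +
          p ^ 2 / h * (2 * ∑ κ ∈ T.neighbors F, localPoly u κ x ^ 2) := by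
        simp only [b₁, Finset.sum_add_distrib, Finset.mul_sum]
        congr 1
        exact Finset.sum_congr rfl fun κ _ => by ring
      rw [e]
      calc _ ≤ 2 * (A * J) := by gcongr
        _ ≤ _ := hy
        _ ≤ _ := by gcongr)
  have h2 := norm_integral_le_of_norm_le (hint hb₂c)
    (f := fun x => penalty T p Cσ F * inner ℝ (jump u F x) (jump u F x))
    (.of_forall fun x => by
      have hj := norm_jump_sq_le u hF x
      rw [real_inner_self_eq_norm_sq, Real.norm_eq_abs, abs_of_nonneg (by positivity)]
      have e : b₂ x = Cσ * Cq * (p ^ 2 / h) *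
          (2 * ∑ κ ∈ T.neighbors F, localPoly u κ x ^ 2) := by
        simp only [b₂, Finset.mul_sum]
        exact Finset.sum_congr rfl fun κ _ => by ring
      rw [e]
      gcongr)
  refine (abs_add_le _ _).trans ?_
  rw [abs_neg]
  refine (add_le_add h1 h2).trans_eq ?_
  rw [← integral_add (hint hb₁c) (hint hb₂c)]
  refine integral_congr_ae (.of_forall fun x => ?_)
  simp only [b₁, b₂, ← Finset.sum_add_distrib]
  exact Finset.sum_congr rfl fun κ _ => by ring

end Face

/-- The quadratic form of the interior penalty method is bounded by `p⁴ / h²` times the square of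
the norm of `L²(Ω)`: on every face, Young's inequality with weights `h / p²` and `p² / h` separates
averages from jumps, and the trace and inverse inequalities bound both. -/
theorem exists_abs_sipg_le (n : ℕ) {Cσ c₂ γ c₃ Cq : ℝ} (hCσ : 0 < Cσ) (hc₂ : 0 < c₂)
    (hγ : 0 < γ) (hc₃ : 0 < c₃) (hCq : 0 < Cq) :
    ∃ C : ℝ, 0 < C ∧ ∀ (Ω : Set (Euc (n + 1))), IsConvexPolytopalDomain Ω →
      ∀ (T : PolyMesh Ω), T.ShapeRegular c₂ → T.ShapeRegularSubtriangulation γ c₃ →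
        T.QuasiUniform Cq → (∀ κ ∈ T.elements, surf (n + 1) (frontier κ) < ∞) ∧
        ∀ p : ℕ, 1 ≤ p → ∀ u : dgSpace T p,
          |sipg Cσ u u| ≤ C * (p ^ 4 / T.meshSize ^ 2) * ‖u‖ ^ 2 := by
  obtain ⟨C, hC, hest⟩ := exists_element_estimates n hc₂ hγ hc₃ hCq
  set M : ℝ := 2 + 2 * (Cσ * Cq) with hM
  have hM0 : 0 < M := by positivity
  refine ⟨(n + 1) * C + ((n + 1) * C ^ 2 + M * C), by positivity, ?_⟩
  intro Ω hΩ T hreg hsub hqu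
  have hsurf : ∀ κ ∈ T.elements, surf (n + 1) (frontier κ) < ∞ := fun κ hκ =>
    (hest Ω hΩ T hreg hsub hqu κ hκ).1
  refine ⟨hsurf, fun p hp u => ?_⟩
  have hh := T.meshSize_pos hΩ
  set h := T.meshSize with hhdef
  have hp0 : (0 : ℝ) < p := by exact_mod_cast hp
  -- the inverse and trace inequalities for `u`
  have hgrad : ∀ κ ∈ T.elements, ∫ x in κ, ‖gradient (localPoly u κ) x‖ ^ 2 ≤
      (n + 1) * C * (p ^ 4 / h ^ 2) * ∫ x in κ, localPoly u κ x ^ 2 := by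
    intro κ hκ
    have hfin : (volume : Measure (Euc (n + 1))) κ < ∞ :=
      (T.isBounded_element hΩ hκ).measure_lt_top
    have he := ((hest Ω hΩ T hreg hsub hqu κ hκ).2 p hp _ (totalDegree_localRep_le u κ)).1
    rw [setIntegral_norm_sq_gradient_localPoly u κ (T.isBounded_element hΩ hκ) hfin]
    refine (Finset.sum_le_sum fun i _ => he i).trans_eq ?_
    rw [Finset.sum_const, Finset.card_univ, Fintype.card_fin, nsmul_eq_mul, localPoly_eq]
    push_cast
    ring
  have htrace : ∀ κ ∈ T.elements, ∫ x in frontier κ, localPoly u κ x ^ 2 ∂(surf (n + 1)) ≤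
      C * (p ^ 2 / h) * ∫ x in κ, localPoly u κ x ^ 2 := by
    intro κ hκ
    rw [localPoly_eq]
    exact ((hest Ω hΩ T hreg hsub hqu κ hκ).2 p hp _ (totalDegree_localRep_le u κ)).2
  have hgtrace : ∀ κ ∈ T.elements,
      ∫ x in frontier κ, ‖gradient (localPoly u κ) x‖ ^ 2 ∂(surf (n + 1)) ≤
      C * (p ^ 2 / h) * ∫ x in κ, ‖gradient (localPoly u κ) x‖ ^ 2 := by
    intro κ hκ
    have hfin : (volume : Measure (Euc (n + 1))) κ < ∞ :=
      (T.isBounded_element hΩ hκ).measure_lt_top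
    have hfr : Bornology.IsBounded (frontier κ) :=
      (T.isBounded_element hΩ hκ).closure.subset frontier_subset_closure
    have he := fun i => ((hest Ω hΩ T hreg hsub hqu κ hκ).2 p hp _
      ((totalDegree_pderiv_le i _).trans (totalDegree_localRep_le u κ))).2
    rw [setIntegral_norm_sq_gradient_localPoly u κ hfr (hsurf κ hκ),
      setIntegral_norm_sq_gradient_localPoly u κ (T.isBounded_element hΩ hκ) hfin, Finset.mul_sum]
    exact Finset.sum_le_sum fun i _ => he i
  -- the contributions of the faces
  set b : Set (Euc (n + 1)) → Euc (n + 1) → ℝ := fun κ x =>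
    h / p ^ 2 * ‖gradient (localPoly u κ) x‖ ^ 2 + M * (p ^ 2 / h) * localPoly u κ x ^ 2 with hb
  have hbc : ∀ κ, Continuous (b κ) := fun κ => by
    have h1 := continuous_gradient_localPoly u κ
    have h2 := continuous_localPoly u κ
    fun_prop
  have hb0 : ∀ κ x, 0 ≤ b κ x := fun κ x => by positivity
  have hface := fun F (hF : F ∈ T.faces) => abs_face_term_le hΩ hCσ hCq hqu hsurf hp u hF
  have hN0 : ∀ κ, 0 ≤ ∫ x in κ, localPoly u κ x ^ 2 := fun κ => integral_nonneg fun _ => sq_nonneg _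
  have hbκ : ∀ κ ∈ T.elements, ∫ x in frontier κ, b κ x ∂(surf (n + 1)) ≤
      ((n + 1) * C ^ 2 + M * C) * (p ^ 4 / h ^ 2) * ∫ x in κ, localPoly u κ x ^ 2 := by
    intro κ hκ
    have hfr : Bornology.IsBounded (frontier κ) :=
      (T.isBounded_element hΩ hκ).closure.subset frontier_subset_closure
    have i1 : IntegrableOn (fun x => h / p ^ 2 * ‖gradient (localPoly u κ) x‖ ^ 2) (frontier κ)
        (surf (n + 1)) := integrableOn_of_continuous hfr (hsurf κ hκ) (by
      have h1 := continuous_gradient_localPoly u κ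
      fun_prop)
    have i2 : IntegrableOn (fun x => M * (p ^ 2 / h) * localPoly u κ x ^ 2) (frontier κ)
        (surf (n + 1)) := integrableOn_of_continuous hfr (hsurf κ hκ) (by
      have h1 := continuous_localPoly u κ
      fun_prop)
    simp only [hb]
    rw [integral_add i1 i2, integral_const_mul, integral_const_mul]
    calc _ ≤ h / p ^ 2 * (C * (p ^ 2 / h) * ((n + 1) * C * (p ^ 4 / h ^ 2) *
            ∫ x in κ, localPoly u κ x ^ 2)) +
          M * (p ^ 2 / h) * (C * (p ^ 2 / h) * ∫ x in κ, localPoly u κ x ^ 2) := by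
          gcongr
          · exact (hgtrace κ hκ).trans (by gcongr; exact hgrad κ hκ)
          · exact htrace κ hκ
      _ = _ := by
          field_simp
  have hD : |∑ κ ∈ T.elements,
      ∫ x in κ, inner ℝ (gradient (localPoly u κ) x) (gradient (localPoly u κ) x)| ≤
      ∑ κ ∈ T.elements, (n + 1) * C * (p ^ 4 / h ^ 2) * ∫ x in κ, localPoly u κ x ^ 2 := by
    simp only [real_inner_self_eq_norm_sq]
    rw [abs_of_nonneg (Finset.sum_nonneg fun κ _ => integral_nonneg fun _ => sq_nonneg _)]
    exact Finset.sum_le_sum hgrad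
  have hsplit : sipg Cσ u u = (∑ κ ∈ T.elements,
      ∫ x in κ, inner ℝ (gradient (localPoly u κ) x) (gradient (localPoly u κ) x)) +
      ∑ F ∈ T.faces,
        (-(∫ x in F, (inner ℝ (avgGrad u F x) (jump u F x) + inner ℝ (jump u F x) (avgGrad u F x))
          ∂(surf (n + 1))) +
        ∫ x in F, penalty T p Cσ F * inner ℝ (jump u F x) (jump u F x) ∂(surf (n + 1))) := by
    rw [sipg, Finset.sum_add_distrib, Finset.sum_neg_distrib]
    ring
  rw [hsplit]
  calc _ ≤ _ := abs_add_le _ _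
    _ ≤ (∑ κ ∈ T.elements, (n + 1) * C * (p ^ 4 / h ^ 2) * ∫ x in κ, localPoly u κ x ^ 2) +
        ∑ κ ∈ T.elements, ((n + 1) * C ^ 2 + M * C) * (p ^ 4 / h ^ 2) *
          ∫ x in κ, localPoly u κ x ^ 2 := by
      refine add_le_add hD ?_
      refine (Finset.abs_sum_le_sum_abs _ _).trans ((Finset.sum_le_sum hface).trans ?_)
      exact (sum_faces_le hΩ hsurf hbc hb0).trans (Finset.sum_le_sum hbκ)
    _ = ((n + 1) * C + ((n + 1) * C ^ 2 + M * C)) * (p ^ 4 / h ^ 2) *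
        ∑ κ ∈ T.elements, ∫ x in κ, localPoly u κ x ^ 2 := by
      rw [← Finset.mul_sum, ← Finset.mul_sum]
      ring
    _ ≤ _ := by
      gcongr
      exact sum_integral_localPoly_sq_le u

/-! ### Bilinearity and the stiffness operator -/

section Bilinear

variable {d : ℕ} {Ω : Set (Euc d)} {T : PolyMesh Ω} {p : ℕ} {F : Set (Euc d)}

theorem jump_add (u v : dgSpace T p) (F : Set (Euc d)) (x : Euc d) :
    jump (u + v) F x = jump u F x + jump v F x := by
  simp [jump, localPoly_add, add_smul, Finset.sum_add_distrib]

theorem jump_smul (c : ℝ) (u : dgSpace T p) (F : Set (Euc d)) (x : Euc d) :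
    jump (c • u) F x = c • jump u F x := by
  simp [jump, localPoly_smul, Finset.smul_sum, mul_smul]

theorem avgGrad_add (u v : dgSpace T p) (F : Set (Euc d)) (x : Euc d) :
    avgGrad (u + v) F x = avgGrad u F x + avgGrad v F x := by
  simp [avgGrad, gradient_localPoly_add, smul_add, Finset.sum_add_distrib]

theorem avgGrad_smul (c : ℝ) (u : dgSpace T p) (F : Set (Euc d)) (x : Euc d) :
    avgGrad (c • u) F x = c • avgGrad u F x := by
  simp only [avgGrad, gradient_localPoly_smul, ← Finset.smul_sum]
  rw [smul_comm]

theorem continuous_avgGrad (u : dgSpace T p) (F : Set (Euc d)) : Continuous (avgGrad u F) := by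
  have h : Continuous fun x => ∑ κ ∈ T.neighbors F, gradient (localPoly u κ) x :=
    continuous_finsetSum _ fun κ _ => continuous_gradient_localPoly u κ
  exact (continuous_const (y := ((T.neighbors F).card : ℝ)⁻¹)).smul h

theorem aestronglyMeasurable_jump (u : dgSpace T p) (F : Set (Euc d)) :
    AEStronglyMeasurable (jump u F) ((surf d).restrict F) := by
  refine Finset.aestronglyMeasurable_fun_sum _ fun κ hκ => ?_
  exact (continuous_localPoly u κ).aestronglyMeasurable.smul
    ((aestronglyMeasurable_outwardNormal (surf d) κ).mono_measure
      (Measure.restrict_mono (PolyMesh.mem_neighbors.1 hκ).2 le_rfl))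

theorem integrableOn_face_of_norm_le {f : Euc d → ℝ} {g : Euc d → ℝ}
    (hsurf : ∀ κ ∈ T.elements, surf d (frontier κ) < ∞) (hF : F ∈ T.faces)
    (hf : AEStronglyMeasurable f ((surf d).restrict F)) (hg : Continuous g)
    (hfg : ∀ x, ‖f x‖ ≤ g x) : IntegrableOn f F (surf d) :=
  Integrable.mono' (integrableOn_of_continuous (T.isBounded_face hF)
    (T.surf_face_lt_top hsurf hF) hg) hf (.of_forall hfg)

theorem integrableOn_avgGrad_jump (hsurf : ∀ κ ∈ T.elements, surf d (frontier κ) < ∞)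
    (hF : F ∈ T.faces) (u v : dgSpace T p) :
    IntegrableOn (fun x => inner ℝ (avgGrad u F x) (jump v F x)) F (surf d) := by
  refine integrableOn_face_of_norm_le hsurf hF
    ((continuous_avgGrad u F).aestronglyMeasurable.inner (aestronglyMeasurable_jump v F))
    (g := fun x => ‖avgGrad u F x‖ * ∑ κ ∈ T.neighbors F, |localPoly v κ x|) ?_ fun x => ?_
  · exact (continuous_avgGrad u F).norm.mul
      (continuous_finsetSum _ fun κ _ => (continuous_localPoly v κ).abs)
  · exact (norm_inner_le_norm _ _).trans (by gcongr; exact norm_jump_le v F x)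

theorem integrableOn_jump_jump (hsurf : ∀ κ ∈ T.elements, surf d (frontier κ) < ∞)
    (hF : F ∈ T.faces) (u v : dgSpace T p) :
    IntegrableOn (fun x => inner ℝ (jump u F x) (jump v F x)) F (surf d) := by
  refine integrableOn_face_of_norm_le hsurf hF
    ((aestronglyMeasurable_jump u F).inner (aestronglyMeasurable_jump v F))
    (g := fun x => (∑ κ ∈ T.neighbors F, |localPoly u κ x|) *
      ∑ κ ∈ T.neighbors F, |localPoly v κ x|) ?_ fun x => ?_
  · exact (continuous_finsetSum _ fun κ _ => (continuous_localPoly u κ).abs).mul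
      (continuous_finsetSum _ fun κ _ => (continuous_localPoly v κ).abs)
  · refine (norm_inner_le_norm _ _).trans ?_
    gcongr
    · exact norm_jump_le u F x
    · exact norm_jump_le v F x

theorem integrableOn_inner_gradient (hΩ : IsConvexPolytopalDomain Ω) {κ : Set (Euc d)}
    (hκ : κ ∈ T.elements) (u v : dgSpace T p) :
    IntegrableOn (fun x => inner ℝ (gradient (localPoly u κ) x) (gradient (localPoly v κ) x))
      κ volume :=
  integrableOn_of_continuous (T.isBounded_element hΩ hκ)
    (T.isBounded_element hΩ hκ).measure_lt_top
    ((continuous_gradient_localPoly u κ).inner (continuous_gradient_localPoly v κ))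

theorem sipg_comm (Cσ : ℝ) (u v : dgSpace T p) : sipg Cσ u v = sipg Cσ v u := by
  unfold sipg
  congr 1
  · congr 1
    · refine Finset.sum_congr rfl fun κ _ => ?_
      simp only [real_inner_comm]
    · refine Finset.sum_congr rfl fun F _ => ?_
      refine integral_congr_ae (.of_forall fun x => ?_)
      simp only
      rw [real_inner_comm, real_inner_comm (avgGrad v F x), add_comm]
  · refine Finset.sum_congr rfl fun F _ => ?_
    simp only [real_inner_comm]

theorem sipg_add_left (hΩ : IsConvexPolytopalDomain Ω)
    (hsurf : ∀ κ ∈ T.elements, surf d (frontier κ) < ∞) (Cσ : ℝ) (u v w : dgSpace T p) :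
    sipg Cσ (u + v) w = sipg Cσ u w + sipg Cσ v w := by
  have e1 : ∀ κ ∈ T.elements, ∫ x in κ, inner ℝ (gradient (localPoly (u + v) κ) x)
      (gradient (localPoly w κ) x) =
      (∫ x in κ, inner ℝ (gradient (localPoly u κ) x) (gradient (localPoly w κ) x)) +
      ∫ x in κ, inner ℝ (gradient (localPoly v κ) x) (gradient (localPoly w κ) x) :=
    fun κ hκ => by
      simp only [gradient_localPoly_add, inner_add_left]
      exact integral_add (integrableOn_inner_gradient hΩ hκ u w)
        (integrableOn_inner_gradient hΩ hκ v w)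
  have i2 : ∀ F ∈ T.faces, ∀ u w : dgSpace T p, IntegrableOn (fun x =>
      (inner ℝ (avgGrad u F x) (jump w F x) + inner ℝ (jump u F x) (avgGrad w F x) : ℝ)) F
        (surf d) := fun F hF u w => by
    refine (integrableOn_avgGrad_jump hsurf hF u w).add ?_
    simpa only [real_inner_comm] using integrableOn_avgGrad_jump hsurf hF w u
  have e2 : ∀ F ∈ T.faces, ∫ x in F, (inner ℝ (avgGrad (u + v) F x) (jump w F x) +
      inner ℝ (jump (u + v) F x) (avgGrad w F x)) ∂(surf d) =
      (∫ x in F, (inner ℝ (avgGrad u F x) (jump w F x) +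
        inner ℝ (jump u F x) (avgGrad w F x)) ∂(surf d)) +
      ∫ x in F, (inner ℝ (avgGrad v F x) (jump w F x) +
        inner ℝ (jump v F x) (avgGrad w F x)) ∂(surf d) := fun F hF => by
    rw [← integral_add (i2 F hF u w) (i2 F hF v w)]
    refine integral_congr_ae (.of_forall fun x => ?_)
    simp only [jump_add, avgGrad_add, inner_add_left]
    ring
  have e3 : ∀ F ∈ T.faces, ∫ x in F, penalty T p Cσ F *
      inner ℝ (jump (u + v) F x) (jump w F x) ∂(surf d) =
      (∫ x in F, penalty T p Cσ F * inner ℝ (jump u F x) (jump w F x) ∂(surf d)) +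
      ∫ x in F, penalty T p Cσ F * inner ℝ (jump v F x) (jump w F x) ∂(surf d) := fun F hF => by
    simp only [integral_const_mul, jump_add, inner_add_left]
    rw [integral_add (integrableOn_jump_jump hsurf hF u w) (integrableOn_jump_jump hsurf hF v w)]
    ring
  unfold sipg
  rw [Finset.sum_congr rfl e1, Finset.sum_congr rfl e2, Finset.sum_congr rfl e3,
    Finset.sum_add_distrib, Finset.sum_add_distrib, Finset.sum_add_distrib]
  ring

theorem sipg_smul_left (Cσ c : ℝ) (u w : dgSpace T p) :
    sipg Cσ (c • u) w = c * sipg Cσ u w := by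
  unfold sipg
  simp only [gradient_localPoly_smul, jump_smul, avgGrad_smul, real_inner_smul_left, ← mul_add,
    mul_left_comm _ c, integral_const_mul, ← Finset.mul_sum]
  ring

/-- The interior penalty form as a bilinear form. -/
noncomputable def sipgForm (hΩ : IsConvexPolytopalDomain Ω)
    (hsurf : ∀ κ ∈ T.elements, surf d (frontier κ) < ∞) (Cσ : ℝ) :
    dgSpace T p →ₗ[ℝ] dgSpace T p →ₗ[ℝ] ℝ :=
  LinearMap.mk₂ ℝ (sipg Cσ) (sipg_add_left hΩ hsurf Cσ) (sipg_smul_left Cσ)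
    (fun u v w => by
      rw [sipg_comm, sipg_add_left hΩ hsurf, sipg_comm Cσ v, sipg_comm Cσ w])
    (fun c u w => by rw [sipg_comm, sipg_smul_left, sipg_comm Cσ w, smul_eq_mul])

end Bilinear

/-- A bilinear form on a finite-dimensional inner product space is represented by a unique
operator. -/
theorem existsUnique_inner_apply_eq {E : Type*} [NormedAddCommGroup E] [InnerProductSpace ℝ E]
    [FiniteDimensional ℝ E] (B : E →ₗ[ℝ] E →ₗ[ℝ] ℝ) :
    ∃! A : Module.End ℝ E, ∀ u v, inner ℝ (A u) v = B u v := by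
  have : CompleteSpace E := FiniteDimensional.complete ℝ E
  let a : E → E := fun u =>
    (InnerProductSpace.toDual ℝ E).symm (LinearMap.toContinuousLinearMap (B u))
  have ha : ∀ u v, inner ℝ (a u) v = B u v := fun u v => by simp [a]
  refine ⟨⟨⟨a, fun u v => ?_⟩, fun c u => ?_⟩, ha, fun A hA => ?_⟩
  · refine ext_inner_right ℝ fun w => ?_
    rw [inner_add_left, ha, ha, ha, map_add, LinearMap.add_apply]
  · refine ext_inner_right ℝ fun w => ?_
    simp only [RingHom.id_apply]
    rw [real_inner_smul_left, ha, ha, map_smul, LinearMap.smul_apply, smul_eq_mul]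
  · ext1 u
    exact ext_inner_right ℝ fun w => (hA u w).trans (ha u w).symm

/-- A bound for the quadratic form of an operator bounds its real eigenvalues. -/
theorem spectralRadius_le_of_abs_inner_le {E : Type*} [NormedAddCommGroup E]
    [InnerProductSpace ℝ E] [FiniteDimensional ℝ E] {A : Module.End ℝ E} {Λ : ℝ}
    (h : ∀ u, |inner ℝ (A u) u| ≤ Λ * ‖u‖ ^ 2) : spectralRadius ℝ A ≤ ENNReal.ofReal Λ := by
  refine iSup₂_le fun μ hμ => ?_
  obtain ⟨u, hu⟩ := (Module.End.hasEigenvalue_iff_mem_spectrum.2 hμ).exists_hasEigenvector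
  have h1 := h u
  rw [hu.apply_eq_smul, real_inner_smul_left, real_inner_self_eq_norm_sq, abs_mul, abs_sq] at h1
  have h2 : 0 < ‖u‖ ^ 2 := pow_pos (norm_pos_iff.2 hu.2) 2
  have h3 : |μ| ≤ Λ := le_of_mul_le_mul_right h1 h2
  rw [← enorm_eq_nnnorm, ← ofReal_norm, Real.norm_eq_abs]
  exact ENNReal.ofReal_le_ofReal h3

end PolyDG

theorem mainTheorem3 (d : ℕ) (hd : d = 2 ∨ d = 3) (Cσ C₁ c₂ γ c₃ Cq : ℝ)
    (hCσ : 0 < Cσ) (hC₁ : 0 < C₁) (hc₂ : 0 < c₂) (hγ : 0 < γ) (hc₃ : 0 < c₃) (hCq : 0 < Cq) :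
    ∃ Ceig : ℝ, 0 < Ceig ∧
      ∀ (Ω : Set (PolyDG.Euc d)), PolyDG.IsConvexPolytopalDomain Ω →
      ∀ (T : PolyDG.PolyMesh Ω), T.TraceCovering C₁ → T.ShapeRegular c₂ →
        T.ShapeRegularSubtriangulation γ c₃ → T.QuasiUniform Cq →
      ∀ p : ℕ, 1 ≤ p →
        (∀ u : PolyDG.dgSpace T p,
          PolyDG.sipg Cσ u u ≤ Ceig * ((p : ℝ) ^ 4 / T.meshSize ^ 2) * ‖u‖ ^ 2) ∧
        (∃! A : Module.End ℝ (PolyDG.dgSpace T p), PolyDG.IsStiffnessOperator Cσ A) ∧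
        (∀ A : Module.End ℝ (PolyDG.dgSpace T p), PolyDG.IsStiffnessOperator Cσ A →
          spectralRadius ℝ A ≤ ENNReal.ofReal (Ceig * ((p : ℝ) ^ 4 / T.meshSize ^ 2))) := by
  obtain ⟨n, rfl⟩ : ∃ n, d = n + 1 := ⟨d - 1, by omega⟩
  obtain ⟨C, hC, hbound⟩ := PolyDG.exists_abs_sipg_le n hCσ hc₂ hγ hc₃ hCq
  refine ⟨C, hC, fun Ω hΩ T _ hreg hsub hqu p hp => ?_⟩
  obtain ⟨hsurf, hb⟩ := hbound Ω hΩ T hreg hsub hqu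
  have : FiniteDimensional ℝ (PolyDG.dgSpace T p) := PolyDG.dgSpace_finiteDimensional
  refine ⟨fun u => (le_abs_self _).trans (hb p hp u),
    PolyDG.existsUnique_inner_apply_eq (PolyDG.sipgForm hΩ hsurf Cσ), fun A hA => ?_⟩
  refine PolyDG.spectralRadius_le_of_abs_inner_le fun u => ?_
  rw [hA u u]
  exact hb p hp u
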